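/- **Setting.** Let $V$ be a finite-dimensional real vector space, $I$ a finite set, $(\alpha_i)_{i\in I}$ a linearly independent family in $V^*$ and $(\alpha_i^\vee)_{i\in I}$ a family in $V$ with $\alpha_i(\alpha_i^\vee)=2$. Put $r_i(v)=v-\alpha_i(v)\alpha_i^\vee$, let $W^v\subset GL(V)$ be the group generated by the $r_i$, and let $\Phi=\{w\alpha_i\mid w\in W^v,\ i\in I\}$ and $Q_+=\sum_i\mathbb R_{\ge0}\alpha_i$. Assume that $(W^v,\{r_i\})$ is a Coxeter system (with length $\ell$), that $\Phi\subset Q_+\cup -Q_+$, that $w\alpha_i\in Q_+\Leftrightarrow \ell(wr_i)>\ell(w)$, and that $\Phi\cap\mathbb R_{>0}\alpha=\{\alpha\}$ for $\alpha\in\Phi$. Let $\Delta_{im}\subset V^*\setminus\{0\}$ be a set of imaginary roots, disjoint from $\mathbb R\Phi$, stable under $\pm W^v$, contained in $Q_+\cup-Q_+$ and such that $\Delta_{im}\cap Q_+$ is $W^v$-stable (moderately imaginary case); put $\Delta=\Phi\cup\Delta_{im}$. The positive vectorial facets are the sets $wF^v(J)$, for $w\in W^v$, $J\subset I$ and $F^v(J)=\{v\mid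 \alpha_i(v)=0\ (i\in J),\ \alpha_i(v)>0\ (i\notin J)\}$; they are spherical if $\langle r_i\mid i\in J\rangle$ is finite. The negative facets are their opposites. The Tits cone $\mathcal T$ is the union of the positive facets. The model apartment $\mathbb A$ is the affine space $V$ with a set $\mathcal M$ of affine hyperplanes (walls) such that each wall has the form $M(\alpha,k)=\{\alpha+k=0\}$ with $\alpha\in\Phi$; for each $\alpha\in\Phi$ the set $\Gamma_\alpha$ of the $k$ with $M(\alpha,k)\in\mathcal M$ is infinite; and the group $W$ generated by the reflections $v\mapsto v-(\alpha(v)+k)\alpha^\vee$ in the walls (where $\alpha^\vee=w\alpha_i^\vee$ for $\alpha=w\alpha_i$) stabilizes $\mathcal M$. For $\alpha\in\Delta_{im}$ put $\Gamma_\alpha=\mathbb R$. Let $D(\alpha,k)=\{\alpha+k\ge0\}$, $D^\circ(\alpha,k)=\{\alpha+k>0\}$, both equal to $\mathbb A$ if $k=\infty$. Subsets are identified with principal filters; a filter is contained in a set if the set is one of its elements. The enclosure $cl(G)$ of a filter $G$ is the filter of the sets that contain an element of $G$ of the form $\bigcap_{\alpha\in\Delta}D(\alpha,k_\alpha)$,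 $k_\alpha\in\Gamma_\alpha\cup\{\infty\}$. The facet $F(x,F^v)$ is the filter of the sets containing an intersection, over $\alpha\in\Delta$, of one $D(\alpha,k_\alpha)$ or $D^\circ(\alpha,k_\alpha)$ each ($k_\alpha\in\Gamma_\alpha\cup\{\infty\}$), which contains the germ of $x+F^v$ at $x$. A chimney is a filter $cl(F+F^v)$, with $F$ a facet and $F^v$ a vectorial facet; its germ is the filter of the sets containing $cl(F+\xi+F^v)$ for some $\xi\in\overline{F^v}$. It is splayed if $F^v$ is spherical, and solid if the direction of its support (the smallest affine subspace containing it) has a finite pointwise fixer in $W^v$. An apartment of type $\mathbb A$ is a set $A$ with a nonempty set of bijections $\mathbb A\to A$ of the form $\{f_0\circ w\mid w\in W\}$; all the notions above are transported to $A$, and the isomorphisms of apartments are the bijections compatible with these sets. An affine hovel (masure affine) of type $\mathbb A$ is a set $\mathcal I$ covered by a set of subsets, called apartments, such that: * (MA1) every apartment has a structure of apartment of type $\mathbb A$; * (MA2) if $F$ is a point, a germ at $x$ of an interval $]x,y]$ with $0\neq y-x\in\pm\mathcal T$, a generic half-line (one whose direction vector is nonzero and lies in a spherical vectorial facet) or a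 solid chimney of an apartment $A$, and $A'$ is an apartment containing $F$, then $A\cap A'$ contains $cl_A(F)$ and there is an isomorphism $A\to A'$ fixing (pointwise some element of) $cl_A(F)$; * (MA3) if $\mathfrak R$ is a germ of splayed chimney and $F$ is a facet or a germ of solid chimney, some apartment contains $\mathfrak R$ and $F$; * (MA4) if $A,A'$ are apartments containing $\mathfrak R$ and $F$ as in (MA3), then $A\cap A'$ contains $cl_A(\mathfrak R\cup F)$ and there is an isomorphism $A\to A'$ fixing this enclosure. A spherical sector face $\mathfrak f$ of $\mathcal I$ is a subset which is, in some apartment, of the form $x+F^v$ with $F^v$ a spherical vectorial facet (of either sign); its closure $\overline{\mathfrak f}$ is $x+\overline{F^v}$, and its germ $\mathrm{germ}_\infty(\mathfrak f)$ is the filter of the sets containing $x+\xi+F^v$ for some $\xi\in\overline{F^v}$. For spherical sector faces $\mathfrak f,\mathfrak f'$, one says that $\mathfrak f$ is parallel to $\mathfrak f'$ ($\mathfrak f\parallel\mathfrak f'$), resp. opposite to $\mathfrak f'$ ($\mathfrak f\ \mathrm{opp}\ \mathfrak f'$), resp. dominates $\mathfrak f'$ ($\mathfrak f\ge\mathfrak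 f'$), if in an apartment containing both germs these are $\mathrm{germ}_\infty(x+F^v)$ and $\mathrm{germ}_\infty(y+F^v)$, resp. $\mathrm{germ}_\infty(x+F^v)$ and $\mathrm{germ}_\infty(y-F^v)$, resp. $\mathrm{germ}_\infty(x+F^v)$ and $\mathrm{germ}_\infty(y+F'^v)$ with $F'^v\subset\overline{F^v}$, for some points $x,y$ and spherical vectorial facets $F^v,F'^v$. **Proposition 3.2.** Let $\mathcal I$ be an affine hovel. All letters $\mathfrak f$ below denote spherical sector faces of $\mathcal I$. 1. Parallelism is an equivalence relation on the spherical sector faces. 2. Dominance is a preorder on the spherical sector faces, compatible with parallelism ($\mathfrak f_1\parallel\mathfrak f\ge\mathfrak f'\parallel\mathfrak f_1'\Rightarrow\mathfrak f_1\ge\mathfrak f_1'$), and parallelism is the associated equivalence relation: $\mathfrak f\parallel\mathfrak f'\Leftrightarrow(\mathfrak f\ge\mathfrak f'\text{ and }\mathfrak f'\ge\mathfrak f)$. Moreover $$\mathfrak f\ge\mathfrak f'\iff\exists\,\mathfrak f_1'\parallel\mathfrak f',\ \mathfrak f_1'\subset\overline{\mathfrak f}\iff\exists\,\mathfrak f_1\parallel\mathfrak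 f,\ \mathfrak f'\subset\overline{\mathfrak f_1}.$$ 3. Opposition is symmetric, and compatible with parallelism and dominance: $\mathfrak f_1\parallel\mathfrak f\ \mathrm{opp}\ \mathfrak f'\parallel\mathfrak f_1'\Rightarrow\mathfrak f_1\ \mathrm{opp}\ \mathfrak f_1'$ and, for all $\mathfrak f,\mathfrak f''$, $$(\exists\,\mathfrak f',\ \mathfrak f\ \mathrm{opp}\ \mathfrak f'\ge\mathfrak f'')\iff(\exists\,\mathfrak f_1',\ \mathfrak f\ge\mathfrak f_1'\ \mathrm{opp}\ \mathfrak f''),$$ $$(\exists\,\mathfrak f',\ \mathfrak f\ \mathrm{opp}\ \mathfrak f'\le\mathfrak f'')\iff(\exists\,\mathfrak f_1',\ \mathfrak f\le\mathfrak f_1'\ \mathrm{opp}\ \mathfrak f'').$$ -/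

import Mathlib

open Set Filter Topology
open scoped Pointwise

namespace Hovel

/-! ### The vectorial Weyl group, roots and vectorial facets -/

/-- Simple roots `α i` in the dual of `V` and simple coroots in `V`, with `α i (α i)^∨ = 2`. -/
structure SimpleRoots (V ι : Type*) [AddCommGroup V] [Module ℝ V] where
  root : ι → Module.Dual ℝ V
  coroot : ι → V
  root_coroot : ∀ i, root i (coroot i) = 2

namespace SimpleRoots

variable {V ι : Type*} [AddCommGroup V] [Module ℝ V] (D : SimpleRoots V ι)

/-- The simple reflection `v ↦ v - α i (v) • (α i)^∨`. -/
noncomputable def refl (i : ι) : V ≃ₗ[ℝ] V := Module.reflection (D.root_coroot i)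

/-- The vectorial Weyl group, generated by the simple reflections. -/
def Wv : Subgroup (V ≃ₗ[ℝ] V) := Subgroup.closure (range D.refl)

/-- The standard parabolic subgroup attached to `J`. -/
def parabolic (J : Set ι) : Subgroup (V ≃ₗ[ℝ] V) := Subgroup.closure (D.refl '' J)

/-- The contragredient action on linear forms, `β ↦ β ∘ w⁻¹`. -/
def act (w : V ≃ₗ[ℝ] V) (β : Module.Dual ℝ V) : Module.Dual ℝ V :=
  β ∘ₗ (w.symm : V →ₗ[ℝ] V)

/-- The real roots: the forms `w (α i)`. -/
def realRoots : Set (Module.Dual ℝ V) := {β | ∃ w ∈ D.Wv, ∃ i, β = act w (D.root i)}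

/-- The linear forms that are combinations of simple roots with nonnegative coefficients. -/
def posCone [Fintype ι] : Set (Module.Dual ℝ V) :=
  {β | ∃ c : ι → ℝ, (∀ i, 0 ≤ c i) ∧ β = ∑ i, c i • D.root i}

/-- The standard facet `F^v(J)` of the closed fundamental chamber. -/
def stdFacet (J : Set ι) : Set V :=
  {v | (∀ i ∈ J, D.root i v = 0) ∧ ∀ i ∉ J, 0 < D.root i v}

/-- The Tits cone: the union of the positive vectorial facets. -/
def titsCone : Set V := {v | ∃ w ∈ D.Wv, ∃ J : Set ι, v ∈ w '' D.stdFacet J}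

/-- Vectorial facets, positive or negative. -/
def IsVFacet (F : Set V) : Prop :=
  ∃ w ∈ D.Wv, ∃ J : Set ι, F = w '' D.stdFacet J ∨ F = -(w '' D.stdFacet J)

/-- Spherical vectorial facets, positive or negative. -/
def IsSphericalVFacet (F : Set V) : Prop :=
  ∃ w ∈ D.Wv, ∃ J : Set ι, (D.parabolic J : Set (V ≃ₗ[ℝ] V)).Finite ∧
    (F = w '' D.stdFacet J ∨ F = -(w '' D.stdFacet J))

end SimpleRoots

/-- The vectorial data: a Coxeter group generated by the simple reflections, with its real roots,
and a set of imaginary roots, in the moderately imaginary case. -/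
structure VectorialDatum (V ι : Type*) [AddCommGroup V] [Module ℝ V] [Fintype ι] extends
    SimpleRoots V ι where
  linearIndependent_root : LinearIndependent ℝ root
  /-- `(W^v, {r_i})` is a Coxeter system, and `w (α i)` is positive if and only if
  `ℓ (w r_i) > ℓ (w)`. -/
  coxeter : ∃ (M : CoxeterMatrix ι) (cs : CoxeterSystem M toSimpleRoots.Wv),
    (∀ i, (cs.simple i : V ≃ₗ[ℝ] V) = toSimpleRoots.refl i) ∧
    ∀ (w : toSimpleRoots.Wv) (i : ι),
      SimpleRoots.act (w : V ≃ₗ[ℝ] V) (root i) ∈ toSimpleRoots.posCone ↔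
        cs.length w < cs.length (w * cs.simple i)
  /-- Every real root is positive or negative. -/
  root_sign : ∀ β ∈ toSimpleRoots.realRoots,
    β ∈ toSimpleRoots.posCone ∨ -β ∈ toSimpleRoots.posCone
  /-- The only positive multiple of a real root that is a real root is itself. -/
  root_reduced : ∀ β ∈ toSimpleRoots.realRoots, ∀ c : ℝ, 0 < c →
    c • β ∈ toSimpleRoots.realRoots → c = 1
  /-- The imaginary roots. -/
  imRoots : Set (Module.Dual ℝ V)
  imRoots_ne_zero : ∀ β ∈ imRoots, β ≠ 0
  imRoots_disjoint : ∀ β ∈ toSimpleRoots.realRoots, ∀ c : ℝ, c • β ∉ imRoots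
  imRoots_neg : ∀ β ∈ imRoots, -β ∈ imRoots
  imRoots_act : ∀ w ∈ toSimpleRoots.Wv, ∀ β ∈ imRoots, SimpleRoots.act w β ∈ imRoots
  /-- Every imaginary root is positive or negative. -/
  imRoots_sign : ∀ β ∈ imRoots,
    β ∈ toSimpleRoots.posCone ∨ -β ∈ toSimpleRoots.posCone
  /-- The set of positive imaginary roots is stable under the vectorial Weyl group. -/
  imRoots_pos : ∀ w ∈ toSimpleRoots.Wv, ∀ β ∈ imRoots, β ∈ toSimpleRoots.posCone →
    SimpleRoots.act w β ∈ toSimpleRoots.posCone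

/-! ### The model apartment

The affine space under `V` is `V` itself, after the choice of an arbitrary origin. -/

/-- The affine hyperplane `M(β, k) = {v | β v + k = 0}`. -/
def hyperplane {V : Type*} [AddCommGroup V] [Module ℝ V] (β : Module.Dual ℝ V) (k : ℝ) : Set V :=
  {v | β v + k = 0}

/-- The affine Weyl group of a set of walls: it is generated by the reflections
`v ↦ v - (β v + k) • β^∨` in the walls `M(β, k)`, for `β = w (α i)` and `β^∨ = w ((α i)^∨)`. -/
def SimpleRoots.affineWeyl {V ι : Type*} [AddCommGroup V] [Module ℝ V] (D : SimpleRoots V ι)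
    (walls : Set (Set V)) : Subgroup (V ≃ᵃ[ℝ] V) :=
  Subgroup.closure {g | ∃ w ∈ D.Wv, ∃ (i : ι) (k : ℝ),
    hyperplane (SimpleRoots.act w (D.root i)) k ∈ walls ∧
    ∀ v, g v = v - (SimpleRoots.act w (D.root i) v + k) • w (D.coroot i)}

/-- The model affine apartment: vectorial data and a set of (real) walls. -/
structure Apartment (V ι : Type*) [AddCommGroup V] [Module ℝ V] [Fintype ι] extends
    VectorialDatum V ι where
  walls : Set (Set V)
  walls_direction : ∀ M ∈ walls, ∃ β ∈ toSimpleRoots.realRoots, ∃ k : ℝ, M = hyperplane β k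
  walls_infinite : ∀ β ∈ toSimpleRoots.realRoots, {k : ℝ | hyperplane β k ∈ walls}.Infinite
  walls_stable : ∀ g ∈ toSimpleRoots.affineWeyl walls, ∀ M ∈ walls, g '' M ∈ walls

namespace Apartment

variable {V ι : Type*} [NormedAddCommGroup V] [NormedSpace ℝ V] [Fintype ι] (𝔸 : Apartment V ι)

/-- The affine Weyl group `W`. -/
def W : Subgroup (V ≃ᵃ[ℝ] V) := 𝔸.toSimpleRoots.affineWeyl 𝔸.walls

/-- All roots, real or imaginary. -/
def roots : Set (Module.Dual ℝ V) := 𝔸.realRoots ∪ 𝔸.imRoots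

/-- `Γ_β ∪ {∞}`, where `Γ_β` is the set of `k` such that `M(β, k)` is a real wall if `β` is a
real root, and `Γ_β = ℝ` if `β` is an imaginary root. -/
def levels (β : Module.Dual ℝ V) : Set (WithTop ℝ) :=
  {k | k = ⊤ ∨ ∃ r : ℝ, k = (r : WithTop ℝ) ∧ (hyperplane β r ∈ 𝔸.walls ∨ β ∈ 𝔸.imRoots)}

/-- The half-space `D(β, k) = {v | β v + k ≥ 0}`, which is `V` for `k = ∞`. -/
def halfSpace (β : Module.Dual ℝ V) (k : WithTop ℝ) : Set V :=
  {v | ((-(β v) : ℝ) : WithTop ℝ) ≤ k}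

/-- The open half-space `D°(β, k) = {v | β v + k > 0}`, which is `V` for `k = ∞`. -/
def openHalfSpace (β : Module.Dual ℝ V) (k : WithTop ℝ) : Set V :=
  {v | ((-(β v) : ℝ) : WithTop ℝ) < k}

/-- The sets `⋂ β, D(β, k_β)`, with one `k_β ∈ Γ_β ∪ {∞}` for each root `β`. -/
def IsEnclosed (Q : Set V) : Prop :=
  ∃ k : Module.Dual ℝ V → WithTop ℝ, (∀ β ∈ 𝔸.roots, k β ∈ 𝔸.levels β) ∧
    Q = ⋂ β ∈ 𝔸.roots, halfSpace β (k β)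

/-- The intersections over all roots `β` of one half-space `D(β, k_β)` or `D°(β, k_β)`,
with `k_β ∈ Γ_β ∪ {∞}`; it is the open one for `β ∈ O`. -/
def IsSemiEnclosed (Q : Set V) : Prop :=
  ∃ (k : Module.Dual ℝ V → WithTop ℝ) (O : Set (Module.Dual ℝ V)),
    (∀ β ∈ 𝔸.roots, k β ∈ 𝔸.levels β) ∧
    Q = ⋂ β ∈ 𝔸.roots, {v | v ∈ halfSpace β (k β) ∧ (β ∈ O → v ∈ openHalfSpace β (k β))}

theorem isEnclosed_univ : 𝔸.IsEnclosed univ :=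
  ⟨fun _ => ⊤, fun _ _ => Or.inl rfl, by simp [halfSpace]⟩

theorem isSemiEnclosed_univ : 𝔸.IsSemiEnclosed univ :=
  ⟨fun _ => ⊤, ∅, fun _ _ => Or.inl rfl, by simp [halfSpace]⟩

theorem IsEnclosed.inter {Q R : Set V} (hQ : 𝔸.IsEnclosed Q) (hR : 𝔸.IsEnclosed R) :
    𝔸.IsEnclosed (Q ∩ R) := by
  obtain ⟨k, hk, rfl⟩ := hQ
  obtain ⟨l, hl, rfl⟩ := hR
  refine ⟨fun β => min (k β) (l β), fun β hβ => ?_, ?_⟩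
  · rcases min_choice (k β) (l β) with h | h <;> simp only [h]
    exacts [hk β hβ, hl β hβ]
  · ext v
    simp only [mem_inter_iff, mem_iInter, halfSpace, mem_ofPred_eq, le_min_iff]
    grind

theorem IsSemiEnclosed.inter {Q R : Set V} (hQ : 𝔸.IsSemiEnclosed Q)
    (hR : 𝔸.IsSemiEnclosed R) : 𝔸.IsSemiEnclosed (Q ∩ R) := by
  obtain ⟨k, O, hk, rfl⟩ := hQ
  obtain ⟨l, P, hl, rfl⟩ := hR
  refine ⟨fun β => min (k β) (l β),
    {β | (k β ≤ l β ∧ β ∈ O) ∨ (l β ≤ k β ∧ β ∈ P)}, fun β hβ => ?_, ?_⟩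
  · rcases min_choice (k β) (l β) with h | h <;> simp only [h]
    exacts [hk β hβ, hl β hβ]
  · ext v
    simp only [mem_inter_iff, mem_iInter, halfSpace, openHalfSpace, mem_ofPred_eq, le_min_iff,
      lt_min_iff, ← forall_and]
    refine forall_congr' fun β => forall_congr' fun _ => ?_
    rcases lt_trichotomy (k β) (l β) with h | h | h
    · have h1 := h.not_ge
      have h2 := h.le
      constructor
      · rintro ⟨⟨a, b⟩, c, d⟩
        exact ⟨⟨a, c⟩, by rintro (⟨_, e⟩ | ⟨e, _⟩); exacts [⟨b e, a.trans_lt h⟩, (h1 e).elim]⟩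
      · rintro ⟨⟨a, c⟩, b⟩
        exact ⟨⟨a, fun e => (b (Or.inl ⟨h2, e⟩)).1⟩, c, fun _ => a.trans_lt h⟩
    · simp only [h, le_refl, true_and, and_self]
      grind
    · have h1 := h.not_ge
      have h2 := h.le
      constructor
      · rintro ⟨⟨a, b⟩, c, d⟩
        exact ⟨⟨a, c⟩, by rintro (⟨e, _⟩ | ⟨_, e⟩); exacts [(h1 e).elim, ⟨c.trans_lt h, d e⟩]⟩
      · rintro ⟨⟨a, c⟩, b⟩
        exact ⟨⟨a, fun _ => c.trans_lt h⟩, c, fun e => (b (Or.inr ⟨h2, e⟩)).2⟩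

/-- The enclosure `cl(G)` of a filter `G`: the sets that contain an element of `G` of the form
`⋂ β, D(β, k_β)`. Here and below a subset of `V` is identified with its principal filter, and
"`G` is contained in `G'`" is `G ≤ G'`. -/
def cl (G : Filter V) : Filter V where
  sets := {S | ∃ Q, 𝔸.IsEnclosed Q ∧ Q ∈ G ∧ Q ⊆ S}
  univ_sets := ⟨univ, 𝔸.isEnclosed_univ, univ_mem, Subset.rfl⟩
  sets_of_superset := fun ⟨Q, h, hG, hQ⟩ hS => ⟨Q, h, hG, hQ.trans hS⟩
  inter_sets := fun ⟨Q, h, hG, hQ⟩ ⟨R, h', hG', hR⟩ =>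
    ⟨Q ∩ R, h.inter 𝔸 h', inter_mem hG hG', inter_subset_inter hQ hR⟩

/-- The facet `F(x, F^v)`: the sets that contain an intersection of half-spaces `D(β, k_β)` or
`D°(β, k_β)` which itself contains the local facet, the germ at `x` of `x + F^v`. -/
def facet (x : V) (F : Set V) : Filter V where
  sets := {S | ∃ Q, 𝔸.IsSemiEnclosed Q ∧ Q ∈ 𝓝[x +ᵥ F] x ∧ Q ⊆ S}
  univ_sets := ⟨univ, 𝔸.isSemiEnclosed_univ, univ_mem, Subset.rfl⟩
  sets_of_superset := fun ⟨Q, h, hG, hQ⟩ hS => ⟨Q, h, hG, hQ.trans hS⟩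
  inter_sets := fun ⟨Q, h, hG, hQ⟩ ⟨R, h', hG', hR⟩ =>
    ⟨Q ∩ R, h.inter 𝔸 h', inter_mem hG hG', inter_subset_inter hQ hR⟩

/-- The chimney `cl(F(x, F₀) + F)` with base `F(x, F₀)` and direction `F`. -/
def chimney (x : V) (F₀ F : Set V) : Filter V := 𝔸.cl (𝔸.facet x F₀ + 𝓟 F)

/-- The germ of a chimney: the sets that contain one of the shortened chimneys
`cl(F(x, F₀) + ξ + F)`, for `ξ` in the closure of `F` (a directed family). -/
def chimneyGerm (x : V) (F₀ F : Set V) : Filter V :=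
  ⨅ ξ ∈ closure F, 𝔸.cl (𝔸.facet x F₀ + 𝓟 (ξ +ᵥ F))

/-- The support of a filter: the smallest affine subspace that contains it. -/
def support (G : Filter V) : AffineSubspace ℝ V := sInf {E | (E : Set V) ∈ G}

/-- A filter is solid if the direction of its support has a finite pointwise fixer in `W^v`. -/
def IsSolid (G : Filter V) : Prop :=
  {w : V ≃ₗ[ℝ] V | w ∈ 𝔸.Wv ∧ ∀ v ∈ (support G).direction, w v = v}.Finite

/-- Solid chimneys. -/
def IsSolidChimney (G : Filter V) : Prop :=
  ∃ x F₀ F, 𝔸.IsVFacet F₀ ∧ 𝔸.IsVFacet F ∧ 𝔸.IsSolid (𝔸.chimney x F₀ F) ∧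
    G = 𝔸.chimney x F₀ F

/-- Germs of solid chimneys. -/
def IsSolidChimneyGerm (G : Filter V) : Prop :=
  ∃ x F₀ F, 𝔸.IsVFacet F₀ ∧ 𝔸.IsVFacet F ∧ 𝔸.IsSolid (𝔸.chimney x F₀ F) ∧
    G = 𝔸.chimneyGerm x F₀ F

/-- Germs of splayed chimneys: those with a spherical direction. -/
def IsSplayedChimneyGerm (G : Filter V) : Prop :=
  ∃ x F₀ F, 𝔸.IsVFacet F₀ ∧ 𝔸.IsSphericalVFacet F ∧ G = 𝔸.chimneyGerm x F₀ F

/-- Facets. -/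
def IsFacet (G : Filter V) : Prop := ∃ x F, 𝔸.IsVFacet F ∧ G = 𝔸.facet x F

/-- Points. -/
def IsPoint (G : Filter V) : Prop := ∃ x : V, G = 𝓟 {x}

/-- Germs at `x` of preordered intervals `]x, x + v]`, with `v ≠ 0` in plus or minus the
Tits cone. -/
def IsPreorderedIntervalGerm (G : Filter V) : Prop :=
  ∃ x v, v ≠ 0 ∧ (v ∈ 𝔸.titsCone ∨ -v ∈ 𝔸.titsCone) ∧
    G = 𝓝[(fun t : ℝ => x + t • v) '' Ioc 0 1] x

/-- Generic half-lines: those whose direction lies in a spherical vectorial facet. -/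
def IsGenericHalfLine (G : Filter V) : Prop :=
  ∃ x v, v ≠ 0 ∧ (∃ F, 𝔸.IsSphericalVFacet F ∧ v ∈ F) ∧
    G = 𝓟 ((fun t : ℝ => x + t • v) '' Ici 0)

/-- The germ at infinity of the sector face `x + F`: the sets that contain one of its shortenings
`x + ξ + F`, for `ξ` in the closure of `F` (a directed family). -/
def sectorFaceGerm (x : V) (F : Set V) : Filter V := ⨅ ξ ∈ closure F, 𝓟 ((x + ξ) +ᵥ F)

end Apartment

/-! ### Affine hovels -/

variable {V ι : Type*} [NormedAddCommGroup V] [NormedSpace ℝ V] [Fintype ι]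

/-- A set `X` covered by a set of subsets (apartments), each with a structure of apartment of
type `𝔸`, given by its set `isom A` of isomorphisms from `V` onto `A`. -/
structure ApartmentSystem (𝔸 : Apartment V ι) (X : Type*) where
  apts : Set (Set X)
  cover : ⋃₀ apts = univ
  isom : Set X → Set (V → X)
  isom_nonempty : ∀ A ∈ apts, (isom A).Nonempty
  isom_injective : ∀ A ∈ apts, ∀ f ∈ isom A, Function.Injective f
  isom_range : ∀ A ∈ apts, ∀ f ∈ isom A, range f = A
  isom_iff : ∀ A ∈ apts, ∀ f₀ ∈ isom A, ∀ f : V → X,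
    f ∈ isom A ↔ ∃ w ∈ 𝔸.W, f = f₀ ∘ w

namespace ApartmentSystem

variable {𝔸 : Apartment V ι} {X : Type*} (S : ApartmentSystem 𝔸 X)

/-- A filter on `X` which, in some apartment, is an object of the kind `P`. -/
def IsOfKind (P : Filter V → Prop) (G : Filter X) : Prop :=
  ∃ A ∈ S.apts, ∃ f ∈ S.isom A, ∃ H, P H ∧ G = map f H

/-- For a filter `G` on `X` contained in the apartments `A` and `A'`: the intersection `A ∩ A'`
contains the enclosure of `G` computed in `A`, and there is an isomorphism from `A` onto `A'`
fixing (some element of) this enclosure. In terms of an isomorphism `f` from `V` onto `A`, an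
isomorphism from `A` onto `A'` is `f' ∘ f⁻¹` with `f' ∈ isom A'`. -/
def SharesEnclosure (A A' : Set X) (G : Filter X) : Prop :=
  ∀ f ∈ S.isom A, A ∩ A' ∈ map f (𝔸.cl (comap f G)) ∧
    ∃ f' ∈ S.isom A', ∀ᶠ v in 𝔸.cl (comap f G), f' v = f v

end ApartmentSystem

/-- Affine hovels (masures affines) of type `𝔸`. The fields `ma2`, `ma3`, `ma4` are the defining
axioms; `A ∈ G` means that the apartment `A` contains the filter `G`. -/
structure AffineHovel (𝔸 : Apartment V ι) (X : Type*) extends ApartmentSystem 𝔸 X where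
  ma2 : ∀ A ∈ apts, ∀ A' ∈ apts, ∀ f ∈ isom A, ∀ H : Filter V,
    (Apartment.IsPoint H ∨ 𝔸.IsPreorderedIntervalGerm H ∨ 𝔸.IsGenericHalfLine H ∨
      𝔸.IsSolidChimney H) →
    A' ∈ map f H → toApartmentSystem.SharesEnclosure A A' (map f H)
  ma3 : ∀ R G : Filter X, toApartmentSystem.IsOfKind 𝔸.IsSplayedChimneyGerm R →
    (toApartmentSystem.IsOfKind 𝔸.IsFacet G ∨
      toApartmentSystem.IsOfKind 𝔸.IsSolidChimneyGerm G) →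
    ∃ A ∈ apts, A ∈ R ∧ A ∈ G
  ma4 : ∀ R G : Filter X, toApartmentSystem.IsOfKind 𝔸.IsSplayedChimneyGerm R →
    (toApartmentSystem.IsOfKind 𝔸.IsFacet G ∨
      toApartmentSystem.IsOfKind 𝔸.IsSolidChimneyGerm G) →
    ∀ A ∈ apts, ∀ A' ∈ apts, A ∈ R → A ∈ G → A' ∈ R → A' ∈ G →
      toApartmentSystem.SharesEnclosure A A' (R ⊔ G)

/-! ### Spherical sector faces, parallelism, dominance and opposition -/

namespace AffineHovel

variable {𝔸 : Apartment V ι} {X : Type*} (S : AffineHovel 𝔸 X)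

/-- `f` is an isomorphism from `V` onto some apartment. -/
def IsChart (f : V → X) : Prop := ∃ A ∈ S.apts, f ∈ S.isom A

/-- The subset `s` of the hovel is, in the chart `f`, the spherical sector face `x + F`. -/
def Presents (s : Set X) (f : V → X) (x : V) (F : Set V) : Prop :=
  S.IsChart f ∧ 𝔸.IsSphericalVFacet F ∧ s = f '' (x +ᵥ F)

/-- The spherical sector faces of a hovel, as subsets. -/
def SphericalSectorFace : Type _ := {s : Set X // ∃ f x F, S.Presents s f x F}

variable {S}

namespace SphericalSectorFace

/-- The germ at infinity of a spherical sector face (every presentation gives the same one). -/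
def germ (s : S.SphericalSectorFace) : Filter X :=
  ⨅ (f : V → X) (x : V) (F : Set V) (_ : S.Presents s.1 f x F), map f (Apartment.sectorFaceGerm x F)

/-- The closure of a spherical sector face, in an apartment that contains it (every presentation
gives the same one). -/
def closure (s : S.SphericalSectorFace) : Set X :=
  ⋃ (f : V → X) (x : V) (F : Set V) (_ : S.Presents s.1 f x F), f '' (x +ᵥ _root_.closure F)

/-- `s` and `t` are parallel: in an apartment that contains both germs, these are germs of
sector faces `x + F` and `y + F`. -/
def Parallel (s t : S.SphericalSectorFace) : Prop :=
  ∃ f, S.IsChart f ∧ ∃ x y F, 𝔸.IsSphericalVFacet F ∧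
    s.germ = map f (Apartment.sectorFaceGerm x F) ∧ t.germ = map f (Apartment.sectorFaceGerm y F)

/-- `s` and `t` have opposite directions: in an apartment that contains both germs, these are
germs of sector faces `x + F` and `y - F`. -/
def Opposite (s t : S.SphericalSectorFace) : Prop :=
  ∃ f, S.IsChart f ∧ ∃ x y F, 𝔸.IsSphericalVFacet F ∧
    s.germ = map f (Apartment.sectorFaceGerm x F) ∧ t.germ = map f (Apartment.sectorFaceGerm y (-F))

/-- `s` dominates `t`: in an apartment that contains both germs, these are germs of sector faces
`x + F` and `y + F'` such that `F'` is contained in the closure of `F`. -/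
def Dominates (s t : S.SphericalSectorFace) : Prop :=
  ∃ f, S.IsChart f ∧ ∃ x y F F', 𝔸.IsSphericalVFacet F ∧ 𝔸.IsSphericalVFacet F' ∧
    F' ⊆ _root_.closure F ∧
    s.germ = map f (Apartment.sectorFaceGerm x F) ∧ t.germ = map f (Apartment.sectorFaceGerm y F')

end SphericalSectorFace

end AffineHovel

end Hovel

/-!
Two apartments that contain the same germ of a spherical sector face and the same point (or a second
such germ) are compared by (MA2) and (MA4): their charts differ by an element of `W` near both
objects. Hence two germs have a relative position: the pair of their directions in a common
apartment, well defined up to `W^v`.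

The key point is that moving a sector face parallel to itself in one apartment does not change its
relative position to another object. Along a segment whose direction lies in a vectorial facet `F₀`
of the Tits cone or of its opposite, the position is locally constant: the apartment that (MA3)
provides for the object and the chimney germ based at the facet `F(p, F₀)` contains the germs of all
nearby sector faces of the segment. Since a spherical facet lies in the interior of the Tits cone or
of its opposite, every translation is obtained from such segments and from translations along the
sector face itself, which do not change its germ. All the assertions then reduce to vectorial facets
of one apartment.
-/

namespace Hovel

section LinearAlgebra

variable {V : Type*} [AddCommGroup V] [Module ℝ V]

theorem surjective_pi_of_linearIndependent {ι : Type*} [Finite ι] {f : ι → Module.Dual ℝ V}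
    (hf : LinearIndependent ℝ f) : Function.Surjective (LinearMap.pi f) := by
  classical
  let _ := Fintype.ofFinite ι
  rw [← LinearMap.dualMap_injective_iff, injective_iff_map_eq_zero]
  intro φ hφ
  have hsum : ∑ i, φ (Pi.single i 1) • f i = 0 := by
    ext v
    have hv : φ (LinearMap.pi f v) = 0 := LinearMap.congr_fun hφ v
    rw [← Finset.univ_sum_single (LinearMap.pi f v), map_sum] at hv
    simp only [LinearMap.sum_apply, LinearMap.smul_apply, smul_eq_mul, LinearMap.zero_apply]
    rw [← hv]
    refine Finset.sum_congr rfl fun i _ => ?_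
    rw [mul_comm, ← smul_eq_mul, ← map_smul, ← Pi.single_smul, smul_eq_mul, mul_one,
      LinearMap.pi_apply]
  ext i
  simpa using Fintype.linearIndependent_iff.1 hf _ hsum i

theorem exists_invariant_form [FiniteDimensional ℝ V] (G : Subgroup (V ≃ₗ[ℝ] V)) [Finite G] :
    ∃ B : LinearMap.BilinForm ℝ V, (∀ g ∈ G, ∀ x y, B (g x) (g y) = B x y) ∧
      ∀ x ≠ 0, 0 < B x x := by
  let _ := Fintype.ofFinite G
  let e : V ≃ₗ[ℝ] EuclideanSpace ℝ (Fin (Module.finrank ℝ V)) :=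
    (Module.finBasis ℝ V).equivFun ≪≫ₗ (WithLp.linearEquiv 2 ℝ _).symm
  let B : LinearMap.BilinForm ℝ V :=
    ∑ g : G, (innerₗ _).compl₁₂ (g.1 ≪≫ₗ e).toLinearMap (g.1 ≪≫ₗ e).toLinearMap
  have hB (x y : V) : B x y = ∑ g : G, inner ℝ (e (g.1 x)) (e (g.1 y)) := by
    simp [B, LinearMap.sum_apply]
  refine ⟨B, fun g hg x y => ?_, fun x hx => ?_⟩
  · rw [hB, hB]
    exact Equiv.sum_comp (Equiv.mulRight (⟨g, hg⟩ : G))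
      fun k : G => inner ℝ (e (k.1 x)) (e (k.1 y))
  · rw [hB]
    refine Finset.sum_pos (fun g _ => real_inner_self_pos.2 ?_) Finset.univ_nonempty
    exact (LinearEquiv.map_ne_zero_iff e).2 ((LinearEquiv.map_ne_zero_iff g.1).2 hx)

theorem tendsto_add_smul_nhdsGT [TopologicalSpace V] [ContinuousAdd V] [ContinuousSMul ℝ V]
    (x v : V) : Tendsto (fun t : ℝ => x + t • v) (𝓝[>] 0) (𝓝 x) := by
  have hcont : Continuous fun t : ℝ => x + t • v := by fun_prop
  simpa using (hcont.tendsto 0).mono_left nhdsWithin_le_nhds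

end LinearAlgebra

/-! ### Real roots and vectorial facets -/

namespace SimpleRoots

section Algebra

variable {V ι : Type*} [AddCommGroup V] [Module ℝ V] {D : SimpleRoots V ι}

@[simp]
theorem act_apply (w : V ≃ₗ[ℝ] V) (β : Module.Dual ℝ V) (v : V) : act w β v = β (w.symm v) :=
  rfl

theorem act_mul (w w' : V ≃ₗ[ℝ] V) (β : Module.Dual ℝ V) : act (w * w') β = act w (act w' β) :=
  rfl

theorem refl_apply (i : ι) (v : V) : D.refl i v = v - D.root i v • D.coroot i :=
  Module.reflection_apply _ _

theorem refl_mem_Wv (i : ι) : D.refl i ∈ D.Wv := Subgroup.subset_closure ⟨i, rfl⟩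

theorem parabolic_le_Wv (J : Set ι) : D.parabolic J ≤ D.Wv :=
  Subgroup.closure_mono (image_subset_range _ _)

theorem act_refl_root (i : ι) : act (D.refl i) (D.root i) = -D.root i := by
  ext v
  rw [act_apply, refl, Module.reflection_symm, Module.reflection_apply]
  simp only [map_sub, map_smul, D.root_coroot, smul_eq_mul, LinearMap.neg_apply]
  ring

theorem act_mem_realRoots {w : V ≃ₗ[ℝ] V} (hw : w ∈ D.Wv) {β : Module.Dual ℝ V}
    (hβ : β ∈ D.realRoots) : act w β ∈ D.realRoots := by
  obtain ⟨w', hw', i, rfl⟩ := hβ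
  exact ⟨w * w', mul_mem hw hw', i, (act_mul _ _ _).symm⟩

theorem neg_mem_realRoots {β : Module.Dual ℝ V} (hβ : β ∈ D.realRoots) : -β ∈ D.realRoots := by
  obtain ⟨w, hw, i, rfl⟩ := hβ
  refine ⟨w * D.refl i, mul_mem hw (refl_mem_Wv i), i, ?_⟩
  rw [act_mul, act_refl_root]
  rfl

variable (D) in
/-- The group `± W^v`, which permutes all the vectorial facets, positive and negative. -/
def signedWv : Subgroup (V ≃ₗ[ℝ] V) where
  carrier := {g | ∃ w ∈ D.Wv, g = w ∨ g = LinearEquiv.neg ℝ * w}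
  one_mem' := ⟨1, one_mem _, Or.inl rfl⟩
  mul_mem' := by
    rintro _ _ ⟨w, hw, rfl | rfl⟩ ⟨w', hw', rfl | rfl⟩
    · exact ⟨_, mul_mem hw hw', Or.inl rfl⟩
    · exact ⟨_, mul_mem hw hw', Or.inr (by ext; simp)⟩
    · exact ⟨_, mul_mem hw hw', Or.inr (mul_assoc _ _ _)⟩
    · exact ⟨_, mul_mem hw hw', Or.inl (by ext; simp)⟩
  inv_mem' := by
    rintro _ ⟨w, hw, rfl | rfl⟩
    · exact ⟨_, inv_mem hw, Or.inl rfl⟩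
    · refine ⟨_, inv_mem hw, Or.inr ?_⟩
      rw [inv_eq_iff_mul_eq_one]
      ext v
      simp

theorem Wv_le_signedWv : D.Wv ≤ D.signedWv := fun w hw => ⟨w, hw, Or.inl rfl⟩

theorem neg_mem_signedWv : LinearEquiv.neg ℝ ∈ D.signedWv := ⟨1, one_mem _, Or.inr rfl⟩

theorem inv_mul_mul_mem_Wv {g u : V ≃ₗ[ℝ] V} (hg : g ∈ D.signedWv) (hu : u ∈ D.Wv) :
    g⁻¹ * u * g ∈ D.Wv := by
  obtain ⟨w, hw, rfl | rfl⟩ := hg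
  · exact mul_mem (mul_mem (inv_mem hw) hu) hw
  · convert mul_mem (mul_mem (inv_mem hw) hu) hw using 1
    rw [mul_inv_rev, mul_assoc, mul_assoc, mul_assoc, mul_right_inj, inv_mul_eq_iff_eq_mul]
    ext v
    simp

theorem image_mul_stdFacet_neg (w : V ≃ₗ[ℝ] V) (J : Set ι) :
    (LinearEquiv.neg ℝ * w : V ≃ₗ[ℝ] V) '' D.stdFacet J = -(w '' D.stdFacet J) := by
  rw [← image_neg_eq_neg, image_image]
  rfl

theorem isVFacet_iff {F : Set V} :
    D.IsVFacet F ↔ ∃ g ∈ D.signedWv, ∃ J : Set ι, F = g '' D.stdFacet J := by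
  constructor
  · rintro ⟨w, hw, J, rfl | rfl⟩
    · exact ⟨w, Wv_le_signedWv hw, J, rfl⟩
    · exact ⟨_, mul_mem neg_mem_signedWv (Wv_le_signedWv hw), J, (image_mul_stdFacet_neg w J).symm⟩
  · rintro ⟨g, ⟨w, hw, rfl | rfl⟩, J, rfl⟩
    · exact ⟨g, hw, J, Or.inl rfl⟩
    · exact ⟨w, hw, J, Or.inr (image_mul_stdFacet_neg w J)⟩

theorem isSphericalVFacet_iff {F : Set V} :
    D.IsSphericalVFacet F ↔ ∃ g ∈ D.signedWv, ∃ J : Set ι,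
      (D.parabolic J : Set (V ≃ₗ[ℝ] V)).Finite ∧ F = g '' D.stdFacet J := by
  constructor
  · rintro ⟨w, hw, J, hJ, rfl | rfl⟩
    · exact ⟨w, Wv_le_signedWv hw, J, hJ, rfl⟩
    · exact ⟨_, mul_mem neg_mem_signedWv (Wv_le_signedWv hw), J, hJ,
        (image_mul_stdFacet_neg w J).symm⟩
  · rintro ⟨g, ⟨w, hw, rfl | rfl⟩, J, hJ, rfl⟩
    · exact ⟨g, hw, J, hJ, Or.inl rfl⟩
    · exact ⟨w, hw, J, hJ, Or.inr (image_mul_stdFacet_neg w J)⟩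

theorem isVFacet_stdFacet (J : Set ι) : D.IsVFacet (D.stdFacet J) :=
  ⟨1, one_mem _, J, Or.inl (by simp)⟩

theorem IsSphericalVFacet.isVFacet {F : Set V} (hF : D.IsSphericalVFacet F) : D.IsVFacet F := by
  obtain ⟨w, hw, J, -, h⟩ := hF
  exact ⟨w, hw, J, h⟩

theorem IsSphericalVFacet.image {F : Set V} (hF : D.IsSphericalVFacet F) {g : V ≃ₗ[ℝ] V}
    (hg : g ∈ D.signedWv) : D.IsSphericalVFacet (g '' F) := by
  obtain ⟨g', hg', J, hJ, rfl⟩ := isSphericalVFacet_iff.1 hF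
  exact isSphericalVFacet_iff.2 ⟨g * g', mul_mem hg hg', J, hJ, by rw [image_image]; rfl⟩

theorem IsSphericalVFacet.neg {F : Set V} (hF : D.IsSphericalVFacet F) :
    D.IsSphericalVFacet (-F) := by
  rw [← image_neg_eq_neg]
  exact hF.image neg_mem_signedWv

theorem IsVFacet.neg {F : Set V} (hF : D.IsVFacet F) : D.IsVFacet (-F) := by
  obtain ⟨w, hw, J, rfl | rfl⟩ := hF
  · exact ⟨w, hw, J, Or.inr rfl⟩
  · exact ⟨w, hw, J, Or.inl (neg_neg _)⟩

theorem IsVFacet.mem_titsCone_or_neg_mem {F : Set V} (hF : D.IsVFacet F) {v : V} (hv : v ∈ F) :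
    v ∈ D.titsCone ∨ -v ∈ D.titsCone := by
  obtain ⟨w, hw, J, rfl | rfl⟩ := hF
  · exact Or.inl ⟨w, hw, J, hv⟩
  · exact Or.inr ⟨w, hw, J, hv⟩

theorem root_nonneg_of_mem_stdFacet {J : Set ι} {v : V} (hv : v ∈ D.stdFacet J) (i : ι) :
    0 ≤ D.root i v := by
  by_cases hi : i ∈ J
  · exact (hv.1 i hi).ge
  · exact (hv.2 i hi).le

theorem exists_mem_stdFacet {v : V} (hv : ∀ i, 0 ≤ D.root i v) : ∃ J, v ∈ D.stdFacet J :=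
  ⟨{i | D.root i v = 0}, fun _ hi => hi, fun i hi => (hv i).lt_of_ne (Ne.symm hi)⟩

theorem smul_mem_stdFacet {J : Set ι} {v : V} (hv : v ∈ D.stdFacet J) {t : ℝ} (ht : 0 < t) :
    t • v ∈ D.stdFacet J :=
  ⟨fun i hi => by rw [map_smul, hv.1 i hi, smul_zero],
    fun i hi => by rw [map_smul]; exact mul_pos ht (hv.2 i hi)⟩

theorem IsVFacet.smul_mem {F : Set V} (hF : D.IsVFacet F) {v : V} (hv : v ∈ F) {t : ℝ}
    (ht : 0 < t) : t • v ∈ F := by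
  obtain ⟨g, -, J, rfl⟩ := isVFacet_iff.1 hF
  obtain ⟨v, hv, rfl⟩ := hv
  exact ⟨t • v, smul_mem_stdFacet hv ht, map_smul g t v⟩

theorem parabolic_apply_eq {J : Set ι} {v : V} (hv : ∀ i ∈ J, D.root i v = 0) {w : V ≃ₗ[ℝ] V}
    (hw : w ∈ D.parabolic J) : w v = v := by
  induction hw using Subgroup.closure_induction with
  | mem x hx =>
    obtain ⟨i, hi, rfl⟩ := hx
    rw [refl_apply, hv i hi, zero_smul, sub_zero]
  | one => rfl
  | mul x y _ _ hx hy => rw [LinearEquiv.mul_apply, hy, hx]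
  | inv x _ hx =>
    change x.symm v = v
    rw [LinearEquiv.symm_apply_eq, hx]

section PositiveCone

variable [Fintype ι] {β : Module.Dual ℝ V}

theorem nonneg_of_mem_posCone (hβ : β ∈ D.posCone) {v : V} (hv : ∀ i, 0 ≤ D.root i v) :
    0 ≤ β v := by
  obtain ⟨c, hc, rfl⟩ := hβ
  simp only [LinearMap.sum_apply, LinearMap.smul_apply, smul_eq_mul]
  exact Finset.sum_nonneg fun i _ => mul_nonneg (hc i) (hv i)

theorem mem_posCone_of_pos (hβ : β ∈ D.posCone ∨ -β ∈ D.posCone) {v : V}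
    (hv : ∀ i, 0 ≤ D.root i v) (h : 0 < β v) : β ∈ D.posCone :=
  hβ.resolve_right fun hneg => by
    have := nonneg_of_mem_posCone hneg hv
    rw [LinearMap.neg_apply] at this
    linarith

theorem eq_zero_of_mem_stdFacet (hβ : β ∈ D.posCone) {J : Set ι} {v u : V}
    (hv : v ∈ D.stdFacet J) (hu : u ∈ D.stdFacet J) (h : β v = 0) : β u = 0 := by
  obtain ⟨c, hc, rfl⟩ := hβ
  simp only [LinearMap.sum_apply, LinearMap.smul_apply, smul_eq_mul] at h ⊢
  rw [Finset.sum_eq_zero_iff_of_nonneg fun i _ =>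
    mul_nonneg (hc i) (root_nonneg_of_mem_stdFacet hv i)] at h
  refine Finset.sum_eq_zero fun i hi => ?_
  by_cases hJ : i ∈ J
  · rw [hu.1 i hJ, mul_zero]
  · rw [(mul_eq_zero.1 (h i hi)).resolve_right (hv.2 i hJ).ne', zero_mul]

theorem nonneg_of_mem_stdFacet (hβ : β ∈ D.posCone ∨ -β ∈ D.posCone) {J : Set ι} {v u : V}
    (hv : v ∈ D.stdFacet J) (hu : u ∈ D.stdFacet J) (h : 0 ≤ β v) : 0 ≤ β u := by
  rcases h.eq_or_lt with h0 | hpos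
  · have hu0 : β u = 0 := by
      rcases hβ with hβ | hβ
      · exact eq_zero_of_mem_stdFacet hβ hv hu h0.symm
      · simpa using eq_zero_of_mem_stdFacet hβ hv hu (by simp [← h0])
    exact hu0.ge
  · exact nonneg_of_mem_posCone (mem_posCone_of_pos hβ (root_nonneg_of_mem_stdFacet hv) hpos)
      (root_nonneg_of_mem_stdFacet hu)

end PositiveCone

/-- Maximize over `w` the value of a `W^v(J)`-invariant scalar product at `w u` and `c`. -/
theorem exists_mem_parabolic_nonneg [FiniteDimensional ℝ V] {J : Set ι}
    (hJ : (D.parabolic J : Set (V ≃ₗ[ℝ] V)).Finite) {c : V} (hc : ∀ j ∈ J, 0 < D.root j c)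
    (u : V) : ∃ w ∈ D.parabolic J, ∀ j ∈ J, 0 ≤ D.root j (w u) := by
  have : Finite (D.parabolic J) := hJ
  obtain ⟨B, hinv, hpos⟩ := exists_invariant_form (D.parabolic J)
  obtain ⟨w, hw, hmax⟩ :=
    (D.parabolic J : Set (V ≃ₗ[ℝ] V)).exists_max_image (fun w => B (w u) c) hJ ⟨1, one_mem _⟩
  refine ⟨w, hw, fun j hj => ?_⟩
  have hr : D.refl j ∈ D.parabolic J := Subgroup.subset_closure ⟨j, hj, rfl⟩
  have ha : D.coroot j ≠ 0 := fun h => by simpa [h] using D.root_coroot j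
  have hBc : 2 * B (D.coroot j) c = D.root j c * B (D.coroot j) (D.coroot j) := by
    have h := hinv _ hr (D.coroot j) c
    simp only [refl_apply, D.root_coroot, map_sub, map_smul, LinearMap.sub_apply,
      LinearMap.smul_apply, smul_eq_mul] at h
    linarith
  have hBc_pos : 0 < B (D.coroot j) c := by
    linarith [mul_pos (hc j hj) (hpos _ ha)]
  have hmul : 0 ≤ D.root j (w u) * B (D.coroot j) c := by
    have h := hmax _ (mul_mem hr hw)
    simp only [LinearEquiv.mul_apply, refl_apply, map_sub, map_smul, LinearMap.sub_apply,
      LinearMap.smul_apply, smul_eq_mul] at h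
    linarith
  exact nonneg_of_mul_nonneg_left hmul hBc_pos

end Algebra

end SimpleRoots

section LinearAlgebra

variable {V : Type*} [NormedAddCommGroup V] [NormedSpace ℝ V] [FiniteDimensional ℝ V]

theorem image_closure_linearEquiv (g : V ≃ₗ[ℝ] V) (S : Set V) :
    g '' closure S = closure (g '' S) :=
  g.toContinuousLinearEquiv.toHomeomorph.image_closure S

end LinearAlgebra

section Facets

variable {V ι : Type*}

namespace VectorialDatum

open SimpleRoots

variable [AddCommGroup V] [Module ℝ V] [Fintype ι] {Φ : VectorialDatum V ι}

variable (Φ) in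
theorem stdFacet_nonempty (J : Set ι) : (Φ.stdFacet J).Nonempty := by
  classical
  obtain ⟨v, hv⟩ := surjective_pi_of_linearIndependent Φ.linearIndependent_root
    fun i => if i ∈ J then 0 else 1
  have hv (i : ι) : Φ.root i v = if i ∈ J then 0 else 1 := congrFun hv i
  exact ⟨v, fun i hi => by rw [hv, if_pos hi], fun i hi => by rw [hv, if_neg hi]; exact one_pos⟩

/-- By induction on the length: if `ℓ (w r_i) < ℓ w`, then `w (α i) ≤ 0` at `v`, hence
`α i (v) = 0`. -/
theorem mem_parabolic_of_apply_eq {J : Set ι} {v : V} (hv : v ∈ Φ.stdFacet J) {w : V ≃ₗ[ℝ] V}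
    (hw : w ∈ Φ.Wv) (h : w v = v) : w ∈ Φ.parabolic J := by
  obtain ⟨M, cs, hs, hl⟩ := Φ.coxeter
  suffices H : ∀ n (w : Φ.Wv), cs.length w = n → (w : V ≃ₗ[ℝ] V) v = v →
      (w : V ≃ₗ[ℝ] V) ∈ Φ.parabolic J from H _ ⟨w, hw⟩ rfl h
  intro n
  induction n using Nat.strong_induction_on with
  | _ n ih =>
    intro w hn h
    by_cases hw1 : w = 1
    · rw [hw1]
      exact one_mem _
    obtain ⟨i, hi⟩ := cs.exists_rightDescent_of_ne_one hw1
    have hlt : cs.length (w * cs.simple i) < cs.length w := hi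
    have hneg : -act (w : V ≃ₗ[ℝ] V) (Φ.root i) ∈ Φ.posCone :=
      (Φ.root_sign _ ⟨w, w.2, i, rfl⟩).resolve_left fun hpos => lt_asymm hlt ((hl w i).1 hpos)
    have hsymm : (w : V ≃ₗ[ℝ] V).symm v = v := by rw [LinearEquiv.symm_apply_eq, h]
    have hroot : Φ.root i v = 0 := by
      have hle := nonneg_of_mem_posCone hneg (root_nonneg_of_mem_stdFacet hv)
      rw [LinearMap.neg_apply, act_apply, hsymm] at hle
      exact le_antisymm (by linarith) (root_nonneg_of_mem_stdFacet hv i)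
    have hJ : i ∈ J := by
      by_contra hJ
      exact (hv.2 i hJ).ne' hroot
    have hshort := ih _ (hn ▸ hlt) (w * cs.simple i) rfl (by
      rw [Subgroup.coe_mul, LinearEquiv.mul_apply, hs, refl_apply, hroot, zero_smul, sub_zero, h])
    rw [Subgroup.coe_mul, hs] at hshort
    exact (Subgroup.mul_mem_cancel_right _
      (Subgroup.subset_closure (mem_image_of_mem Φ.refl hJ))).1 hshort

end VectorialDatum

namespace SimpleRoots

section Nonempty

variable [AddCommGroup V] [Module ℝ V] [Fintype ι] {Φ : VectorialDatum V ι} {F : Set V}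

theorem IsVFacet.nonempty (hF : Φ.IsVFacet F) : F.Nonempty := by
  obtain ⟨g, -, J, rfl⟩ := isVFacet_iff.1 hF
  exact (Φ.stdFacet_nonempty J).image g

theorem IsSphericalVFacet.finite_fixer (hF : Φ.IsSphericalVFacet F) :
    {w : V ≃ₗ[ℝ] V | w ∈ Φ.Wv ∧ ∀ v ∈ F, w v = v}.Finite := by
  obtain ⟨g, hg, J, hJ, rfl⟩ := isSphericalVFacet_iff.1 hF
  refine (hJ.image fun u => g * u * g⁻¹).subset ?_
  rintro u ⟨hu, hfix⟩
  obtain ⟨v, hv⟩ := Φ.stdFacet_nonempty J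
  refine ⟨g⁻¹ * u * g,
    VectorialDatum.mem_parabolic_of_apply_eq hv (inv_mul_mul_mem_Wv hg hu) ?_, by group⟩
  rw [LinearEquiv.mul_apply, LinearEquiv.mul_apply, hfix _ ⟨v, hv, rfl⟩]
  exact g.symm_apply_apply v

end Nonempty

section Closure

variable [NormedAddCommGroup V] [NormedSpace ℝ V]

section

variable {D : SimpleRoots V ι} {F : Set V}

theorem IsVFacet.smul_mem_closure (hF : D.IsVFacet F) {v : V} (hv : v ∈ closure F) {t : ℝ}
    (ht : 0 < t) : t • v ∈ closure F :=
  map_mem_closure (continuous_const_smul t) hv fun _ hx => hF.smul_mem hx ht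

theorem IsVFacet.mem_closure_of_add_smul (hF : D.IsVFacet F) {a v : V}
    (h : ∀ t : ℝ, 0 < t → a + t • v ∈ closure F) : v ∈ closure F := by
  have hlim : Tendsto (fun t : ℝ => t⁻¹ • a + v) atTop (𝓝 v) := by
    simpa using ((tendsto_inv_atTop_zero (𝕜 := ℝ)).smul_const a).add_const v
  refine isClosed_closure.mem_of_tendsto hlim ?_
  filter_upwards [eventually_gt_atTop 0] with t ht
  have hmem := hF.smul_mem_closure (h t ht) (inv_pos.2 ht)
  rwa [smul_add, smul_smul, inv_mul_cancel₀ ht.ne', one_smul] at hmem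

theorem root_of_mem_closure_stdFacet [FiniteDimensional ℝ V] {J : Set ι} {v : V}
    (hv : v ∈ closure (D.stdFacet J)) :
    (∀ i ∈ J, D.root i v = 0) ∧ ∀ i, 0 ≤ D.root i v := by
  have hc (i : ι) : Continuous (D.root i) := (D.root i).continuous_of_finiteDimensional
  exact ⟨fun i hi => closure_minimal (fun _ hu => hu.1 i hi)
      (isClosed_eq (hc i) continuous_const) hv,
    fun i => closure_minimal (fun _ hu => root_nonneg_of_mem_stdFacet hu i)
      (isClosed_le continuous_const (hc i)) hv⟩

theorem IsVFacet.add_mem [FiniteDimensional ℝ V] (hF : D.IsVFacet F) {v u : V}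
    (hv : v ∈ closure F) (hu : u ∈ F) : v + u ∈ F := by
  obtain ⟨g, -, J, rfl⟩ := isVFacet_iff.1 hF
  rw [← image_closure_linearEquiv] at hv
  obtain ⟨v, hv, rfl⟩ := hv
  obtain ⟨u, hu, rfl⟩ := hu
  obtain ⟨hzero, hnonneg⟩ := root_of_mem_closure_stdFacet hv
  refine ⟨v + u, ⟨fun i hi => ?_, fun i hi => ?_⟩, map_add g v u⟩
  · rw [map_add, hzero i hi, hu.1 i hi, add_zero]
  · rw [map_add]
    exact add_pos_of_nonneg_of_pos (hnonneg i) (hu.2 i hi)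

theorem IsVFacet.add_mem_closure [FiniteDimensional ℝ V] (hF : D.IsVFacet F) {v u : V}
    (hv : v ∈ closure F) (hu : u ∈ closure F) : v + u ∈ closure F :=
  map_mem_closure (continuous_const_add v) hu fun _ hx => hF.add_mem hv hx

end

variable [Fintype ι] {Φ : VectorialDatum V ι} {F : Set V}

theorem IsVFacet.zero_mem_closure (hF : Φ.IsVFacet F) : (0 : V) ∈ closure F := by
  obtain ⟨v, hv⟩ := hF.nonempty
  have hlim : Tendsto (fun t : ℝ => t⁻¹ • v) atTop (𝓝 0) := by
    simpa using (tendsto_inv_atTop_zero (𝕜 := ℝ)).smul_const v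
  refine mem_closure_of_tendsto hlim ?_
  filter_upwards [eventually_gt_atTop 0] with t ht
  exact hF.smul_mem hv (inv_pos.2 ht)

variable [FiniteDimensional ℝ V]

theorem eventually_dominant_of_mem_stdFacet {J : Set ι}
    (hJ : (Φ.parabolic J : Set (V ≃ₗ[ℝ] V)).Finite) {ζ : V} (hζ : ζ ∈ Φ.stdFacet J) :
    ∀ᶠ u in 𝓝 ζ, ∃ w ∈ Φ.parabolic J, ∀ i, 0 ≤ Φ.root i (w u) := by
  have hpos : ∀ᶠ u in 𝓝 ζ, ∀ w ∈ (Φ.parabolic J : Set (V ≃ₗ[ℝ] V)), ∀ i ∉ J,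
      0 < Φ.root i (w u) := by
    rw [hJ.eventually_all]
    refine fun w hw => (toFinite Jᶜ).eventually_all.2 fun i hi => ?_
    have hcont : Continuous fun u => Φ.root i (w u) :=
      (Φ.root i ∘ₗ w.toLinearMap).continuous_of_finiteDimensional
    refine (hcont.tendsto ζ).eventually_const_lt ?_
    rw [parabolic_apply_eq hζ.1 hw]
    exact hζ.2 i hi
  obtain ⟨c, hc⟩ := Φ.stdFacet_nonempty ∅
  filter_upwards [hpos] with u hu
  obtain ⟨w, hw, hnonneg⟩ :=
    exists_mem_parabolic_nonneg hJ (fun j _ => hc.2 j (notMem_empty j)) u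
  refine ⟨w, hw, fun i => ?_⟩
  by_cases hi : i ∈ J
  · exact hnonneg i hi
  · exact (hu w hw i hi).le

theorem IsSphericalVFacet.eventually_dominant (hF : Φ.IsSphericalVFacet F) {ζ : V} (hζ : ζ ∈ F) :
    ∀ᶠ u in 𝓝 ζ, ∃ g ∈ Φ.signedWv,
      (∀ i, 0 ≤ Φ.root i (g.symm ζ)) ∧ ∀ i, 0 ≤ Φ.root i (g.symm u) := by
  obtain ⟨g, hg, J, hJ, rfl⟩ := isSphericalVFacet_iff.1 hF
  obtain ⟨ζ, hζ, rfl⟩ := hζ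
  have hcont : Tendsto g.symm (𝓝 (g ζ)) (𝓝 ζ) := by
    simpa using (g.symm.toLinearMap.continuous_of_finiteDimensional).tendsto (g ζ)
  filter_upwards [hcont.eventually (eventually_dominant_of_mem_stdFacet hJ hζ)]
  rintro u ⟨w, hw, hu⟩
  refine ⟨g * w⁻¹, mul_mem hg (Wv_le_signedWv (parabolic_le_Wv J (inv_mem hw))),
    fun i => ?_, hu⟩
  change 0 ≤ Φ.root i (w (g.symm (g ζ)))
  rw [g.symm_apply_apply, parabolic_apply_eq hζ.1 hw]
  exact root_nonneg_of_mem_stdFacet hζ i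

theorem IsSphericalVFacet.eventually_mem_facet (hF : Φ.IsSphericalVFacet F) {ζ : V}
    (hζ : ζ ∈ F) : ∀ᶠ u in 𝓝 ζ, ∃ F₀, Φ.IsVFacet F₀ ∧ u ∈ F₀ := by
  filter_upwards [hF.eventually_dominant hζ]
  rintro u ⟨g, hg, -, hu⟩
  obtain ⟨J, hJ⟩ := exists_mem_stdFacet hu
  exact ⟨g '' Φ.stdFacet J, isVFacet_iff.2 ⟨g, hg, J, rfl⟩, _, hJ, g.apply_symm_apply u⟩

end Closure

end SimpleRoots

end Facets

namespace Apartment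

open SimpleRoots

variable {V ι : Type*} [NormedAddCommGroup V] [NormedSpace ℝ V] [Fintype ι] {𝔸 : Apartment V ι}
  {β : Module.Dual ℝ V}

theorem roots_sign (hβ : β ∈ 𝔸.roots) : β ∈ 𝔸.posCone ∨ -β ∈ 𝔸.posCone :=
  hβ.elim (𝔸.root_sign β) (𝔸.imRoots_sign β)

theorem neg_mem_roots (hβ : β ∈ 𝔸.roots) : -β ∈ 𝔸.roots :=
  hβ.imp neg_mem_realRoots (𝔸.imRoots_neg β)

theorem act_mem_roots {g : V ≃ₗ[ℝ] V} (hg : g ∈ 𝔸.signedWv) (hβ : β ∈ 𝔸.roots) :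
    act g β ∈ 𝔸.roots := by
  obtain ⟨w, hw, rfl | rfl⟩ := hg
  · exact hβ.imp (act_mem_realRoots hw) (𝔸.imRoots_act g hw β)
  · have hact : act (LinearEquiv.neg ℝ * w) β = -act w β := by
      ext v
      change β (w.symm (-v)) = -β (w.symm v)
      rw [map_neg, map_neg]
    rw [hact]
    exact neg_mem_roots (hβ.imp (act_mem_realRoots hw) (𝔸.imRoots_act w hw β))

theorem symm_act_mem_roots {g : V ≃ₗ[ℝ] V} (hg : g ∈ 𝔸.signedWv) (hβ : β ∈ 𝔸.roots) :
    act g.symm β ∈ 𝔸.roots :=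
  act_mem_roots (inv_mem hg) hβ

variable [FiniteDimensional ℝ V] {F G : Set V}

theorem root_nonneg_of_mem_closure (hF : 𝔸.IsVFacet F) (hβ : β ∈ 𝔸.roots) {v u : V} (hv : v ∈ F)
    (hu : u ∈ closure F) (h : 0 ≤ β v) : 0 ≤ β u := by
  refine closure_minimal (t := {u | 0 ≤ β u}) (fun u hu => ?_)
    (isClosed_le continuous_const β.continuous_of_finiteDimensional) hu
  obtain ⟨g, hg, J, rfl⟩ := isVFacet_iff.1 hF
  obtain ⟨v, hv, rfl⟩ := hv
  obtain ⟨u, hu, rfl⟩ := hu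
  exact nonneg_of_mem_stdFacet (β := act g.symm β) (roots_sign (symm_act_mem_roots hg hβ)) hv hu h

theorem root_eq_zero_of_mem_closure (hF : 𝔸.IsVFacet F) (hβ : β ∈ 𝔸.roots) {v u : V} (hv : v ∈ F)
    (hu : u ∈ closure F) (h : β v = 0) : β u = 0 := by
  have hneg := root_nonneg_of_mem_closure hF (neg_mem_roots hβ) hv hu (by simp [h])
  rw [LinearMap.neg_apply] at hneg
  exact le_antisymm (by linarith) (root_nonneg_of_mem_closure hF hβ hv hu h.ge)

theorem subset_of_subset_closure (hF : 𝔸.IsVFacet F) (hG : 𝔸.IsVFacet G) (hFG : F ⊆ closure G)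
    (hGF : G ⊆ closure F) : F ⊆ G := by
  intro v hv
  obtain ⟨g, hg, J, rfl⟩ := isVFacet_iff.1 hG
  obtain ⟨u, hu⟩ := 𝔸.stdFacet_nonempty J
  obtain ⟨v', hv', rfl⟩ := (image_closure_linearEquiv g _).ge (hFG hv)
  obtain ⟨hzero, hnonneg⟩ := root_of_mem_closure_stdFacet hv'
  refine mem_image_of_mem g ⟨hzero, fun i hi => (hnonneg i).lt_of_ne fun h => ?_⟩
  have hroot : act g (𝔸.root i) ∈ 𝔸.roots :=
    act_mem_roots hg (Or.inl ⟨1, one_mem _, i, rfl⟩)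
  have hui := root_eq_zero_of_mem_closure hF hroot hv (hGF (mem_image_of_mem g hu))
    (by simpa using h.symm)
  exact (hu.2 i hi).ne' (by simpa using hui)

theorem facet_eq_of_subset_closure (hF : 𝔸.IsVFacet F) (hG : 𝔸.IsVFacet G) (hFG : F ⊆ closure G)
    (hGF : G ⊆ closure F) : F = G :=
  (subset_of_subset_closure hF hG hFG hGF).antisymm (subset_of_subset_closure hG hF hGF hFG)

theorem eventually_root_nonneg (hF : 𝔸.IsSphericalVFacet F) {ζ : V} (hζ : ζ ∈ F) :
    ∀ᶠ u in 𝓝 ζ, ∀ β ∈ 𝔸.roots, 0 < β ζ → 0 ≤ β u := by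
  filter_upwards [hF.eventually_dominant hζ]
  rintro u ⟨g, hg, hζ, hu⟩ β hβ hpos
  have hsign := roots_sign (symm_act_mem_roots hg hβ)
  have hcone := mem_posCone_of_pos hsign hζ (by simpa using hpos)
  simpa using nonneg_of_mem_posCone hcone hu

/-! ### Walls and enclosed sets -/

section Walls

variable {V ι : Type*} [NormedAddCommGroup V] [NormedSpace ℝ V] [Fintype ι] {𝔸 : Apartment V ι}
  {β : Module.Dual ℝ V}

theorem affineEquiv_apply_add (g : V ≃ᵃ[ℝ] V) (a b : V) : g (a + b) = g a + g.linear b := by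
  simpa [add_comm] using g.map_vadd a b

theorem affineEquiv_image_vadd (g : V ≃ᵃ[ℝ] V) (x : V) (F : Set V) :
    g '' (x +ᵥ F) = g x +ᵥ g.linear '' F := by
  simp only [← image_vadd, image_image, vadd_eq_add, affineEquiv_apply_add]

theorem linear_mem_Wv {g : V ≃ᵃ[ℝ] V} (hg : g ∈ 𝔸.W) : g.linear ∈ 𝔸.Wv := by
  suffices H : 𝔸.W ≤ 𝔸.Wv.comap AffineEquiv.linearHom from H hg
  refine (Subgroup.closure_le _).2 ?_
  rintro g ⟨w, hw, i, k, -, hgv⟩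
  change g.linear ∈ 𝔸.Wv
  have hlin : g.linear = w * 𝔸.refl i * w⁻¹ := by
    ext v
    have hdiff : g.linear v = g v - g 0 := by
      rw [eq_sub_iff_add_eq', ← affineEquiv_apply_add, zero_add]
    change _ = w (𝔸.refl i (w.symm v))
    simp only [hdiff, hgv, refl_apply, map_sub, map_smul, LinearEquiv.apply_symm_apply, act_apply,
      map_zero]
    module
  rw [hlin]
  exact mul_mem (mul_mem hw (𝔸.refl_mem_Wv i)) (inv_mem hw)

theorem exists_reflection {w : V ≃ₗ[ℝ] V} (hw : w ∈ 𝔸.Wv) (i : ι) {k : ℝ}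
    (hk : hyperplane (act w (𝔸.root i)) k ∈ 𝔸.walls) :
    ∃ g ∈ 𝔸.W, ∀ v, g v = v - (act w (𝔸.root i) v + k) • w (𝔸.coroot i) := by
  have hpair : act w (𝔸.root i) (w (𝔸.coroot i)) = 2 := by simp [𝔸.root_coroot]
  let g : V ≃ᵃ[ℝ] V := (Module.reflection hpair).toAffineEquiv.trans
    (AffineEquiv.constVAdd ℝ V (-(k • w (𝔸.coroot i))))
  have hg (v : V) : g v = v - (act w (𝔸.root i) v + k) • w (𝔸.coroot i) := by
    change -(k • w (𝔸.coroot i)) + Module.reflection hpair v = _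
    rw [Module.reflection_apply]
    module
  exact ⟨g, Subgroup.subset_closure ⟨w, hw, i, k, hk, hg⟩, hg⟩

theorem hyperplane_reflect_mem_walls (hβ : β ∈ 𝔸.realRoots) {k l : ℝ}
    (hk : hyperplane β k ∈ 𝔸.walls) (hl : hyperplane β l ∈ 𝔸.walls) :
    hyperplane β (2 * k - l) ∈ 𝔸.walls := by
  obtain ⟨w, hw, i, rfl⟩ := hβ
  obtain ⟨g, hg, hgv⟩ := exists_reflection hw i hk
  have hroot (v : V) : act w (𝔸.root i) (g v) = -act w (𝔸.root i) v - 2 * k := by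
    simp only [hgv, act_apply, map_sub, map_smul, LinearEquiv.symm_apply_apply, 𝔸.root_coroot,
      smul_eq_mul]
    ring
  have hinv : Function.Involutive g := fun v => by
    rw [hgv (g v), hroot, hgv v]
    module
  convert 𝔸.walls_stable g hg _ hl using 1
  rw [image_eq_preimage_of_inverse hinv.leftInverse hinv.rightInverse]
  ext v
  simp only [hyperplane, mem_ofPred_eq, mem_preimage, hroot]
  constructor <;> intro h <;> linarith

theorem exists_hyperplane_mem_walls (hβ : β ∈ 𝔸.realRoots) (c : ℝ) :
    ∃ k, c ≤ k ∧ hyperplane β k ∈ 𝔸.walls := by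
  obtain ⟨a, ha, b, hb, hab⟩ := (𝔸.walls_infinite β hβ).nontrivial.exists_lt
  have hn (n : ℕ) : hyperplane β (a + n * (2 * (b - a))) ∈ 𝔸.walls := by
    induction n with
    | zero => simpa using ha
    | succ n ih =>
      convert hyperplane_reflect_mem_walls hβ hb (hyperplane_reflect_mem_walls hβ ha ih) using 2
      push_cast
      ring
  obtain ⟨n, hle⟩ := exists_nat_ge ((c - a) / (2 * (b - a)))
  refine ⟨_, ?_, hn n⟩
  rw [div_le_iff₀ (by linarith)] at hle
  linarith

theorem root_eq_zero_of_mem_stdFacet_univ (hβ : β ∈ 𝔸.roots) {v : V} (hv : v ∈ 𝔸.stdFacet univ) :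
    β v = 0 := by
  have hzero {γ : Module.Dual ℝ V} (h : γ ∈ 𝔸.posCone) : γ v = 0 := by
    obtain ⟨c, -, rfl⟩ := h
    simp only [LinearMap.sum_apply, LinearMap.smul_apply, hv.1 _ (mem_univ _), smul_zero,
      Finset.sum_const_zero]
  exact (roots_sign hβ).elim hzero fun h => by simpa using hzero h

theorem zero_mem_stdFacet_univ : (0 : V) ∈ 𝔸.stdFacet univ :=
  ⟨fun _ _ => map_zero _, fun _ hi => (hi (mem_univ _)).elim⟩

theorem subset_closure_of_vadd_subset {F G : Set V} (hF : 𝔸.IsVFacet F) (hG : 𝔸.IsVFacet G)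
    {x y : V} (h : y +ᵥ G ⊆ x +ᵥ closure F) : G ⊆ closure F := by
  intro u hu
  refine hF.mem_closure_of_add_smul (a := y - x) fun t ht => ?_
  obtain ⟨c, hc, he⟩ := h ⟨t • u, hG.smul_mem hu ht, rfl⟩
  simp only [vadd_eq_add] at he
  rwa [sub_add_eq_add_sub, ← he, add_sub_cancel_left]

end Walls

section Enclosed

variable {V ι : Type*} [NormedAddCommGroup V] [NormedSpace ℝ V] [Fintype ι] {𝔸 : Apartment V ι}
  {β : Module.Dual ℝ V} {Q : Set V}

theorem mem_halfSpace {k : WithTop ℝ} {v : V} :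
    v ∈ halfSpace β k ↔ ∀ r : ℝ, k = r → 0 ≤ β v + r := by
  induction k with
  | top => simp [halfSpace]
  | coe r =>
    simp only [halfSpace, mem_ofPred_eq, WithTop.coe_le_coe, WithTop.coe_inj, forall_eq',
      neg_le_iff_add_nonneg']

theorem isEnclosed_iff : 𝔸.IsEnclosed Q ↔ ∃ k : Module.Dual ℝ V → WithTop ℝ,
    (∀ β ∈ 𝔸.roots, k β ∈ 𝔸.levels β) ∧
      ∀ v, v ∈ Q ↔ ∀ β ∈ 𝔸.roots, ∀ r : ℝ, k β = r → 0 ≤ β v + r := by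
  simp only [IsEnclosed, Set.ext_iff, mem_iInter, mem_halfSpace]

theorem IsEnclosed.isSemiEnclosed (hQ : 𝔸.IsEnclosed Q) : 𝔸.IsSemiEnclosed Q := by
  obtain ⟨k, hk, rfl⟩ := hQ
  exact ⟨k, ∅, hk, by simp⟩

variable (𝔸) in
theorem exists_isEnclosed_isBounded (x : V) :
    ∃ Q, 𝔸.IsEnclosed Q ∧ x ∈ Q ∧ Bornology.IsBounded (LinearMap.pi 𝔸.root '' Q) := by
  classical
  choose! c hcx hc using fun β (hβ : β ∈ 𝔸.realRoots) => exists_hyperplane_mem_walls hβ (-β x)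
  refine ⟨_, isEnclosed_iff.2 ⟨fun β => if β ∈ 𝔸.realRoots then (c β : WithTop ℝ) else ⊤,
    fun β _ => ?_, fun v => Iff.rfl⟩, fun β _ r hr => ?_,
    Bornology.forall_isBounded_image_eval_iff.1 fun i => ?_⟩
  · beta_reduce
    split_ifs with hβ
    · exact Or.inr ⟨_, rfl, Or.inl (hc β hβ)⟩
    · exact Or.inl rfl
  · beta_reduce at hr
    split_ifs at hr with hβ
    · rw [← WithTop.coe_injective hr]
      linarith [hcx β hβ]
    · exact (WithTop.top_ne_coe hr).elim
  · have hroot : 𝔸.root i ∈ 𝔸.realRoots := ⟨1, one_mem _, i, rfl⟩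
    have hneg := neg_mem_realRoots hroot
    refine (Metric.isBounded_Icc (-c (𝔸.root i)) (c (-𝔸.root i))).subset ?_
    rintro _ ⟨_, ⟨v, hv, rfl⟩, rfl⟩
    have hlower := hv _ (Or.inl hroot) _ (if_pos hroot)
    have hupper := hv _ (Or.inl hneg) _ (if_pos hneg)
    rw [LinearMap.neg_apply] at hupper
    change 𝔸.root i v ∈ _
    exact ⟨by linarith, by linarith⟩

theorem nonneg_of_halfLine {a ζ : V} {r : ℝ} (h : ∀ t : ℝ, 0 ≤ t → 0 ≤ β (a + t • ζ) + r) :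
    0 ≤ β ζ := by
  by_contra! hneg
  have hzero := h 0 le_rfl
  simp only [zero_smul, add_zero] at hzero
  have hfar := h ((β a + r + 1) / (-β ζ)) (div_nonneg (by linarith) (by linarith))
  rw [map_add, map_smul, smul_eq_mul] at hfar
  have hcancel : (β a + r + 1) / (-β ζ) * β ζ = -(β a + r + 1) := by
    field_simp [hneg.ne]
  linarith

variable [FiniteDimensional ℝ V] {F : Set V}

theorem IsEnclosed.isClosed (hQ : 𝔸.IsEnclosed Q) : IsClosed Q := by
  obtain ⟨k, -, hk⟩ := isEnclosed_iff.1 hQ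
  have hinter : Q = ⋂ β ∈ 𝔸.roots, ⋂ r : ℝ, ⋂ _ : k β = r, {v | 0 ≤ β v + r} := by
    ext v
    simp only [hk, mem_iInter, mem_ofPred_eq]
  rw [hinter]
  exact isClosed_biInter fun β _ => isClosed_iInter fun r => isClosed_iInter fun _ =>
    isClosed_le continuous_const (β.continuous_of_finiteDimensional.add continuous_const)

theorem IsEnclosed.add_mem (hQ : 𝔸.IsEnclosed Q) (hF : 𝔸.IsVFacet F) {a ζ : V} (hζ : ζ ∈ F)
    (ha : ∀ t : ℝ, 0 ≤ t → a + t • ζ ∈ Q) {b c : V} (hb : b ∈ Q) (hc : c ∈ closure F) :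
    b + c ∈ Q := by
  obtain ⟨k, -, hk⟩ := isEnclosed_iff.1 hQ
  simp only [hk] at ha hb ⊢
  intro β hβ r hr
  have hβc := root_nonneg_of_mem_closure hF hβ hζ hc
    (nonneg_of_halfLine fun t ht => ha t ht β hβ r hr)
  rw [map_add]
  linarith [hb β hβ r hr]

end Enclosed

/-! ### Germs of sector faces and of chimneys -/

section SectorFaceGerm

variable {V ι : Type*} [NormedAddCommGroup V] [NormedSpace ℝ V] [FiniteDimensional ℝ V]
  [Fintype ι] {𝔸 : Apartment V ι} {F G M : Set V} {x y : V}

theorem vadd_closure_eq_of_vadd_eq {V : Type*} [NormedAddCommGroup V] {F G : Set V} {x y : V}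
    (h : x +ᵥ F = y +ᵥ G) : x +ᵥ closure F = y +ᵥ closure G := by
  rw [← closure_vadd, ← closure_vadd, h]

theorem mem_sectorFaceGerm (hF : 𝔸.IsVFacet F) :
    M ∈ sectorFaceGerm x F ↔ ∃ ξ ∈ closure F, (x + ξ) +ᵥ F ⊆ M := by
  rw [sectorFaceGerm, mem_biInf_of_directed]
  · simp only [mem_principal]
  · intro ξ hξ η hη
    refine ⟨ξ + η, hF.add_mem_closure hξ hη, ?_, ?_⟩ <;>
      simp only [ge_iff_le, Order.Preimage, principal_mono] <;> rintro _ ⟨u, hu, rfl⟩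
    · exact ⟨η + u, hF.add_mem hη hu, by simp only [vadd_eq_add]; abel⟩
    · exact ⟨ξ + u, hF.add_mem hξ hu, by simp only [vadd_eq_add]; abel⟩
  · exact ⟨0, hF.zero_mem_closure⟩

theorem vadd_mem_sectorFaceGerm (hF : 𝔸.IsVFacet F) (x : V) : x +ᵥ F ∈ sectorFaceGerm x F :=
  (mem_sectorFaceGerm hF).2 ⟨0, hF.zero_mem_closure, by rw [add_zero]⟩

theorem sectorFaceGerm_add (hF : 𝔸.IsVFacet F) (x : V) {ξ : V} (hξ : ξ ∈ closure F) :
    sectorFaceGerm (x + ξ) F = sectorFaceGerm x F := by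
  ext M
  rw [mem_sectorFaceGerm hF, mem_sectorFaceGerm hF]
  constructor
  · rintro ⟨η, hη, h⟩
    exact ⟨ξ + η, hF.add_mem_closure hξ hη, by rwa [← add_assoc]⟩
  · rintro ⟨η, hη, h⟩
    refine ⟨η, hη, Subset.trans ?_ h⟩
    rintro _ ⟨u, hu, rfl⟩
    exact ⟨ξ + u, hF.add_mem hξ hu, by simp only [vadd_eq_add]; abel⟩

theorem direction_eq_of_sectorFaceGerm_eq (hF : 𝔸.IsVFacet F) (hG : 𝔸.IsVFacet G)
    (h : sectorFaceGerm x F = sectorFaceGerm y G) : F = G := by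
  have hsub {F G : Set V} (hF : 𝔸.IsVFacet F) (hG : 𝔸.IsVFacet G) {x y : V}
      (h : sectorFaceGerm x F = sectorFaceGerm y G) : G ⊆ closure F := by
    have hmem := vadd_mem_sectorFaceGerm hF x
    rw [h, mem_sectorFaceGerm hG] at hmem
    obtain ⟨ξ, -, hξ⟩ := hmem
    exact subset_closure_of_vadd_subset hF hG (hξ.trans (vadd_set_mono subset_closure))
  exact facet_eq_of_subset_closure hF hG (hsub hG hF h.symm) (hsub hF hG h)

theorem direction_eq_of_vadd_eq (hF : 𝔸.IsVFacet F) (hG : 𝔸.IsVFacet G)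
    (h : x +ᵥ F = y +ᵥ G) : F = G :=
  facet_eq_of_subset_closure hF hG
    (subset_closure_of_vadd_subset hG hF (h.le.trans (vadd_set_mono subset_closure)))
    (subset_closure_of_vadd_subset hF hG (h.ge.trans (vadd_set_mono subset_closure)))

theorem sectorFaceGerm_eq_of_vadd_eq (hF : 𝔸.IsVFacet F) (hG : 𝔸.IsVFacet G)
    (h : x +ᵥ F = y +ᵥ G) : sectorFaceGerm x F = sectorFaceGerm y G := by
  obtain rfl := direction_eq_of_vadd_eq hF hG h
  have hx : x ∈ y +ᵥ closure F :=
    vadd_closure_eq_of_vadd_eq h ▸ ⟨0, hF.zero_mem_closure, by simp⟩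
  obtain ⟨ξ, hξ, rfl⟩ := hx
  exact sectorFaceGerm_add hF y hξ

theorem map_sectorFaceGerm (hF : 𝔸.IsVFacet F) (g : V ≃ᵃ[ℝ] V)
    (hF' : 𝔸.IsVFacet (g.linear '' F)) (x : V) :
    map g (sectorFaceGerm x F) = sectorFaceGerm (g x) (g.linear '' F) := by
  ext M
  rw [mem_map, mem_sectorFaceGerm hF, mem_sectorFaceGerm hF', ← image_closure_linearEquiv,
    exists_mem_image]
  simp only [← affineEquiv_apply_add, ← affineEquiv_image_vadd, image_subset_iff]

end SectorFaceGerm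

section Chimney

variable {V ι : Type*} [NormedAddCommGroup V] [NormedSpace ℝ V] [Fintype ι] {𝔸 : Apartment V ι}
  {F₀ F M : Set V} {x : V}

theorem mem_closure_of_mem_facet (hF₀ : 𝔸.IsVFacet F₀) (hM : M ∈ 𝔸.facet x F₀) :
    x ∈ closure M := by
  obtain ⟨Q, -, hQ, hQM⟩ := hM
  have hx : x ∈ closure (x +ᵥ F₀) := by
    rw [closure_vadd]
    exact ⟨0, hF₀.zero_mem_closure, by simp⟩
  have : (𝓝[x +ᵥ F₀] x).NeBot := mem_closure_iff_nhdsWithin_neBot.1 hx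
  have hfreq : ∃ᶠ v in 𝓝[x +ᵥ F₀] x, v ∈ M := Eventually.frequently (mem_of_superset hQ hQM)
  exact mem_closure_iff_frequently.2 (hfreq.filter_mono nhdsWithin_le_nhds)

theorem isSplayedChimneyGerm (hF₀ : 𝔸.IsVFacet F₀) (hF : 𝔸.IsSphericalVFacet F) (x : V) :
    𝔸.IsSplayedChimneyGerm (𝔸.chimneyGerm x F₀ F) :=
  ⟨x, F₀, F, hF₀, hF, rfl⟩

theorem IsEnclosed.mem_facet {Q : Set V} (hQ : 𝔸.IsEnclosed Q) (hx : x ∈ Q) :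
    Q ∈ 𝔸.facet x (𝔸.stdFacet univ) := by
  refine ⟨Q, hQ.isSemiEnclosed, mem_of_superset self_mem_nhdsWithin ?_, Subset.rfl⟩
  obtain ⟨k, -, hk⟩ := isEnclosed_iff.1 hQ
  rintro _ ⟨u, hu, rfl⟩
  refine (hk _).2 fun β hβ r hr => ?_
  simpa [root_eq_zero_of_mem_stdFacet_univ hβ hu] using (hk x).1 hx β hβ r hr

variable [FiniteDimensional ℝ V]

theorem vadd_closure_subset_of_mem_cl (hF₀ : 𝔸.IsVFacet F₀) {ξ : V}
    (hM : M ∈ 𝔸.cl (𝔸.facet x F₀ + 𝓟 (ξ +ᵥ F))) : (x + ξ) +ᵥ closure F ⊆ M := by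
  obtain ⟨Q, hQ, hmem, hQM⟩ := hM
  obtain ⟨T, hT, U, hU, hTU⟩ := Filter.mem_add.1 hmem
  rw [mem_principal] at hU
  refine Subset.trans ?_ hQM
  rw [← closure_vadd]
  refine closure_minimal ?_ hQ.isClosed
  rintro _ ⟨u, hu, rfl⟩
  have hcont : Continuous fun p : V => p + (ξ + u) := by fun_prop
  have h := map_mem_closure hcont (mem_closure_of_mem_facet hF₀ hT) (t := Q) fun p hp =>
    hTU (add_mem_add hp (hU ⟨u, hu, rfl⟩))
  simpa [add_assoc, hQ.isClosed.closure_eq] using h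

theorem sectorFaceGerm_le_chimneyGerm (x : V) (hF₀ : 𝔸.IsVFacet F₀) :
    sectorFaceGerm x F ≤ 𝔸.chimneyGerm x F₀ F :=
  iInf₂_mono fun _ _ _ hM =>
    (vadd_set_mono subset_closure).trans (vadd_closure_subset_of_mem_cl hF₀ hM)

theorem isSolid_chimney (x : V) (hF₀ : 𝔸.IsVFacet F₀) (hF : 𝔸.IsSphericalVFacet F) :
    𝔸.IsSolid (𝔸.chimney x F₀ F) := by
  refine hF.finite_fixer.subset fun w ⟨hw, hfix⟩ => ⟨hw, fun v hv => hfix v ?_⟩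
  have hsub : x +ᵥ closure F ⊆ (support (𝔸.chimney x F₀ F) : Set V) := by
    rw [support, AffineSubspace.coe_sInf]
    refine subset_iInter₂ fun E (hE : (E : Set V) ∈ 𝔸.cl (𝔸.facet x F₀ + 𝓟 F)) => ?_
    rw [← zero_vadd V F] at hE
    simpa using vadd_closure_subset_of_mem_cl hF₀ hE
  simpa using AffineSubspace.vsub_mem_direction (hsub ⟨v, subset_closure hv, rfl⟩)
    (hsub ⟨0, hF.isVFacet.zero_mem_closure, rfl⟩)

theorem isSolidChimneyGerm (hF₀ : 𝔸.IsVFacet F₀) (hF : 𝔸.IsSphericalVFacet F) (x : V) :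
    𝔸.IsSolidChimneyGerm (𝔸.chimneyGerm x F₀ F) :=
  ⟨x, F₀, F, hF₀, hF.isVFacet, isSolid_chimney x hF₀ hF, rfl⟩

/-- Only the values of the simple roots matter, and the vectors on which the roots positive at `ζ`
are `≥ -1` form a neighbourhood of `0`, which absorbs bounded sets. -/
theorem exists_le_add_smul (hF : 𝔸.IsSphericalVFacet F) {ζ : V} (hζ : ζ ∈ F) {S : Set V}
    (hS : Bornology.IsBounded (LinearMap.pi 𝔸.root '' S)) :
    ∃ T : ℝ, 0 < T ∧ ∀ u ∈ S, ∀ v ∈ S, ∀ β ∈ 𝔸.roots, 0 < β ζ → β u ≤ β (v + T • ζ) := by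
  obtain ⟨σ, hσ⟩ := (LinearMap.pi 𝔸.root).exists_rightInverse_of_surjective
    (LinearMap.range_eq_top.2 (surjective_pi_of_linearIndependent 𝔸.linearIndependent_root))
  have hlim : Tendsto (fun a => ζ + σ a) (𝓝 0) (𝓝 ζ) := by
    simpa using ((σ.continuous_of_finiteDimensional.tendsto 0).const_add ζ)
  obtain ⟨T₀, hT₀⟩ := absorbs_iff_norm.1
    (NormedSpace.isVonNBounded_of_isBounded ℝ (hS.sub hS)
      (hlim.eventually (eventually_root_nonneg hF hζ)))
  have hT : 0 < max T₀ 1 := lt_max_of_lt_right one_pos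
  refine ⟨max T₀ 1, hT, fun u hu v hv β hβ hpos => ?_⟩
  set T := max T₀ 1
  obtain ⟨a, ha, hav⟩ := hT₀ T ((le_max_left _ _).trans (le_abs_self T))
    (sub_mem_sub (mem_image_of_mem _ hv) (mem_image_of_mem _ hu))
  have hker : v - u - T • σ a ∈ 𝔸.stdFacet univ := by
    refine ⟨fun i _ => ?_, fun i hi => (hi (mem_univ i)).elim⟩
    have hi := congrFun (hav.trans (map_sub (LinearMap.pi 𝔸.root) v u).symm) i
    have hσi : 𝔸.root i (σ a) = a i := congrFun (LinearMap.congr_fun hσ a) i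
    simp only [LinearMap.pi_apply, Pi.smul_apply] at hi
    rw [map_sub, map_smul, hσi, ← hi, sub_self]
  have hval := root_eq_zero_of_mem_stdFacet_univ hβ hker
  have hnonneg := mul_nonneg hT.le (ha β hβ hpos)
  simp only [map_sub, map_add, map_smul, smul_eq_mul] at hval hnonneg ⊢
  linarith

/-- `Q₁` is cut out by those of the half-spaces defining `Q` whose boundary is parallel to `F`. -/
theorem IsEnclosed.exists_parallel_part {Q : Set V} (hQ : 𝔸.IsEnclosed Q) (hF : 𝔸.IsVFacet F)
    {ζ : V} (hζ : ζ ∈ F) (ha : ∀ t : ℝ, 0 ≤ t → x + t • ζ ∈ Q) :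
    ∃ Q₁, 𝔸.IsEnclosed Q₁ ∧ Q ⊆ Q₁ ∧ (∀ b, ∀ c ∈ closure F, b + c ∈ Q₁ ↔ b ∈ Q₁) ∧
      ∀ v ∈ Q₁, ∀ q ∈ Q, (∀ β ∈ 𝔸.roots, 0 < β ζ → β q ≤ β v) → v ∈ Q := by
  classical
  obtain ⟨k, hk, hkQ⟩ := isEnclosed_iff.1 hQ
  have hparallel (β : Module.Dual ℝ V) (r : ℝ) :
      (if β ζ = 0 then k β else ⊤) = r ↔ β ζ = 0 ∧ k β = r := by
    split_ifs with h <;> simp [h]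
  refine ⟨{v | ∀ β ∈ 𝔸.roots, ∀ r : ℝ, (if β ζ = 0 then k β else ⊤) = r → 0 ≤ β v + r},
    isEnclosed_iff.2 ⟨_, fun β hβ => ?_, fun v => Iff.rfl⟩, fun v hv β hβ r hr => ?_,
    fun b c hc => ?_, fun v hv q hq hle => (hkQ v).2 fun β hβ r hr => ?_⟩
  · split_ifs
    · exact hk β hβ
    · exact Or.inl rfl
  · exact (hkQ v).1 hv β hβ r ((hparallel β r).1 hr).2
  · refine forall₄_congr fun β hβ r hr => ?_
    rw [map_add, root_eq_zero_of_mem_closure hF hβ hζ hc ((hparallel β r).1 hr).1, add_zero]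
  · have hnonneg : 0 ≤ β ζ := nonneg_of_halfLine fun t ht => (hkQ _).1 (ha t ht) β hβ r hr
    rcases hnonneg.eq_or_lt with hzero | hpos
    · exact hv β hβ r ((hparallel β r).2 ⟨hzero.symm, hr⟩)
    · linarith [(hkQ q).1 hq β hβ r hr, hle β hβ hpos]

theorem IsEnclosed.mem_chimneyGerm {Q : Set V} (hQ : 𝔸.IsEnclosed Q)
    (hF : 𝔸.IsSphericalVFacet F) {ξ ζ : V} (hξ : ξ ∈ closure F) (hζ : ζ ∈ F)
    (h : ∀ t : ℝ, 0 ≤ t → x + ξ + t • ζ ∈ Q) : Q ∈ 𝔸.chimneyGerm x (𝔸.stdFacet univ) F := by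
  have hxξ : x + ξ ∈ Q := by simpa using h 0 le_rfl
  obtain ⟨Q₁, hQ₁, hQQ₁, hadd, hmem⟩ := hQ.exists_parallel_part hF.isVFacet hζ h
  obtain ⟨Q₂, hQ₂, hxQ₂, hbdd⟩ := 𝔸.exists_isEnclosed_isBounded x
  obtain ⟨T, hT, hle⟩ := exists_le_add_smul hF hζ hbdd
  have hxQ₁ : x ∈ Q₁ := (hadd x ξ hξ).1 (hQQ₁ hxξ)
  have hshift : ξ + T • ζ ∈ closure F :=
    hF.isVFacet.add_mem_closure hξ (subset_closure (hF.isVFacet.smul_mem hζ hT))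
  refine mem_iInf_of_mem (ξ + T • ζ) (mem_iInf_of_mem hshift ⟨Q, hQ, Filter.mem_add.2
    ⟨Q₁ ∩ Q₂, (hQ₁.inter 𝔸 hQ₂).mem_facet ⟨hxQ₁, hxQ₂⟩, _, mem_principal_self _, ?_⟩, Subset.rfl⟩)
  rintro _ ⟨v, ⟨hvQ₁, hvQ₂⟩, _, ⟨u, hu, rfl⟩, rfl⟩
  simp only [vadd_eq_add, ← add_assoc]
  refine hQ.add_mem hF.isVFacet hζ h ?_ (subset_closure hu)
  rw [add_assoc v]
  refine hmem _ ((hadd v _ hshift).2 hvQ₁) _ hxξ fun β hβ hpos => ?_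
  have := hle x hxQ₂ v hvQ₂ β hβ hpos
  simp only [map_add] at this ⊢
  linarith

end Chimney

section ChimneyGerm

variable {V ι : Type*} [NormedAddCommGroup V] [NormedSpace ℝ V] [FiniteDimensional ℝ V]
  [Fintype ι] {𝔸 : Apartment V ι} {F₀ F M : Set V} {x : V}

theorem exists_mem_cl_of_mem_chimneyGerm (hF : 𝔸.IsVFacet F) (hM : M ∈ 𝔸.chimneyGerm x F₀ F) :
    ∃ ξ ∈ closure F, M ∈ 𝔸.cl (𝔸.facet x F₀ + 𝓟 (ξ +ᵥ F)) := by
  have hmono {G G' : Filter V} (h : G ≤ G') : 𝔸.cl G ≤ 𝔸.cl G' :=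
    fun M ⟨Q, hQ, hQG, hQM⟩ => ⟨Q, hQ, h hQG, hQM⟩
  have hvadd {ξ η : V} (hη : η ∈ closure F) : (ξ + η) +ᵥ F ⊆ ξ +ᵥ F := by
    rintro _ ⟨u, hu, rfl⟩
    exact ⟨η + u, hF.add_mem hη hu, by simp only [vadd_eq_add, add_assoc]⟩
  rwa [chimneyGerm, mem_biInf_of_directed _ ⟨0, hF.zero_mem_closure⟩] at hM
  refine fun ξ hξ η hη => ⟨ξ + η, hF.add_mem_closure hξ hη,
    hmono (add_le_add le_rfl (principal_mono.2 (hvadd hη))),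
    hmono (add_le_add le_rfl (principal_mono.2 ?_))⟩
  rw [add_comm]
  exact hvadd hξ

theorem IsEnclosed.add_mem_of_mem_germ {Q : Set V} (hQ : 𝔸.IsEnclosed Q) (hF : 𝔸.IsVFacet F)
    (hx : Q ∈ sectorFaceGerm x F) {b c : V} (hb : b ∈ Q) (hc : c ∈ closure F) : b + c ∈ Q := by
  obtain ⟨ξ, -, hsub⟩ := (mem_sectorFaceGerm hF).1 hx
  obtain ⟨ζ, hζ⟩ := hF.nonempty
  refine hQ.add_mem hF hζ (a := x + ξ + ζ) (fun t ht => hsub ?_) hb hc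
  exact ⟨(1 + t) • ζ, hF.smul_mem hζ (by linarith), by simp only [vadd_eq_add]; module⟩

end ChimneyGerm

end Apartment

namespace AffineHovel

open SimpleRoots Apartment

/-! ### Comparison of charts -/

theorem subset_preimage_range_of_eqOn {V X : Type*} {f g : V → X} {φ : V → V} {Q : Set V}
    (h : EqOn (g ∘ φ) f Q) : Q ⊆ f ⁻¹' range g :=
  fun v hv => ⟨φ v, h hv⟩

section Charts

variable {V ι : Type*} [NormedAddCommGroup V] [NormedSpace ℝ V] [Fintype ι] {𝔸 : Apartment V ι}
  {X : Type*} {S : AffineHovel 𝔸 X} {f g : V → X} {F : Set V} {x y : V}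

theorem IsChart.range_mem_apts (hf : S.IsChart f) : range f ∈ S.apts := by
  obtain ⟨A, hA, hf⟩ := hf
  rwa [S.isom_range A hA f hf]

theorem IsChart.mem_isom_range (hf : S.IsChart f) : f ∈ S.isom (range f) := by
  obtain ⟨A, hA, hf⟩ := hf
  rwa [S.isom_range A hA f hf]

theorem IsChart.injective (hf : S.IsChart f) : Function.Injective f := by
  obtain ⟨A, hA, hf⟩ := hf
  exact S.isom_injective A hA f hf

theorem IsChart.comp (hf : S.IsChart f) {w : V ≃ᵃ[ℝ] V} (hw : w ∈ 𝔸.W) : S.IsChart (f ∘ w) :=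
  ⟨_, hf.range_mem_apts, (S.isom_iff _ hf.range_mem_apts f hf.mem_isom_range _).2 ⟨w, hw, rfl⟩⟩

theorem exists_isChart_range_eq {A : Set X} (hA : A ∈ S.apts) : ∃ f, S.IsChart f ∧ range f = A := by
  obtain ⟨f, hf⟩ := S.isom_nonempty A hA
  exact ⟨f, ⟨A, hA, hf⟩, S.isom_range A hA f hf⟩

theorem IsChart.exists_eqOn_of_sharesEnclosure (hf : S.IsChart f) (hg : S.IsChart g) {G : Filter X}
    (h : S.SharesEnclosure (range f) (range g) G) :
    ∃ w ∈ 𝔸.W, ∃ Q, 𝔸.IsEnclosed Q ∧ Q ∈ comap f G ∧ EqOn (g ∘ w) f Q := by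
  obtain ⟨-, f', hf', Q, hQ, hQG, heq⟩ := h f hf.mem_isom_range
  obtain ⟨w, hw, rfl⟩ := (S.isom_iff _ hg.range_mem_apts g hg.mem_isom_range f').1 hf'
  exact ⟨w, hw, Q, hQ, hQG, heq⟩

theorem IsChart.exists_eqOn_of_ma2 (hf : S.IsChart f) (hg : S.IsChart g) {H : Filter V}
    (hH : IsPoint H ∨ 𝔸.IsPreorderedIntervalGerm H ∨ 𝔸.IsGenericHalfLine H ∨ 𝔸.IsSolidChimney H)
    (h : range g ∈ map f H) :
    ∃ w ∈ 𝔸.W, ∃ Q, 𝔸.IsEnclosed Q ∧ Q ∈ H ∧ EqOn (g ∘ w) f Q := by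
  have := hf.exists_eqOn_of_sharesEnclosure hg
    (S.ma2 _ hf.range_mem_apts _ hg.range_mem_apts f hf.mem_isom_range H hH h)
  rwa [comap_map hf.injective] at this

theorem IsChart.exists_eqOn_of_point (hf : S.IsChart f) (hg : S.IsChart g) (hx : f x ∈ range g) :
    ∃ w ∈ 𝔸.W, ∃ Q, 𝔸.IsEnclosed Q ∧ x ∈ Q ∧ EqOn (g ∘ w) f Q := by
  obtain ⟨w, hw, Q, hQ, hxQ, heq⟩ := hf.exists_eqOn_of_ma2 hg (.inl ⟨x, rfl⟩)
    (mem_map.2 (mem_principal.2 (singleton_subset_iff.2 hx)))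
  exact ⟨w, hw, Q, hQ, hxQ rfl, heq⟩

theorem IsChart.exists_eqOn_of_halfLine (hf : S.IsChart f) (hg : S.IsChart g)
    (hF : 𝔸.IsSphericalVFacet F) {ζ : V} (hζ : ζ ∈ F)
    (h : ∀ t : ℝ, 0 ≤ t → f (x + t • ζ) ∈ range g) :
    ∃ w ∈ 𝔸.W, ∃ Q, 𝔸.IsEnclosed Q ∧ (∀ t : ℝ, 0 ≤ t → x + t • ζ ∈ Q) ∧ EqOn (g ∘ w) f Q := by
  rcases eq_or_ne ζ 0 with rfl | hζ0
  · simp only [smul_zero, add_zero] at h ⊢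
    obtain ⟨w, hw, Q, hQ, hxQ, heq⟩ := hf.exists_eqOn_of_point hg (h 0 le_rfl)
    exact ⟨w, hw, Q, hQ, fun _ _ => hxQ, heq⟩
  · obtain ⟨w, hw, Q, hQ, hxQ, heq⟩ := hf.exists_eqOn_of_ma2 hg
      (.inr (.inr (.inl ⟨x, ζ, hζ0, ⟨F, hF, hζ⟩, rfl⟩)))
      (mem_map.2 (mem_principal.2 (image_subset_iff.2 h)))
    exact ⟨w, hw, Q, hQ, fun t ht => hxQ ⟨t, ht, rfl⟩, heq⟩

theorem map_comp_sectorFaceGerm [FiniteDimensional ℝ V] {w : V ≃ᵃ[ℝ] V} (hw : w ∈ 𝔸.W)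
    (hF : 𝔸.IsSphericalVFacet F) (x : V) :
    map (f ∘ w) (sectorFaceGerm x F) = map f (sectorFaceGerm (w x) (w.linear '' F)) := by
  rw [← Filter.map_map, map_sectorFaceGerm hF.isVFacet w
    (hF.image (Wv_le_signedWv (linear_mem_Wv hw))).isVFacet]

theorem IsChart.direction_eq [FiniteDimensional ℝ V] (hf : S.IsChart f) {G : Set V}
    (hF : 𝔸.IsSphericalVFacet F) (hG : 𝔸.IsSphericalVFacet G)
    (h : map f (sectorFaceGerm x F) = map f (sectorFaceGerm y G)) : F = G :=
  direction_eq_of_sectorFaceGerm_eq hF.isVFacet hG.isVFacet (map_injective hf.injective h)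

/-- The axioms (MA3) and (MA4), stated for facets and germs of solid chimneys, apply to the filter
`γ` when it is contained in such an object `K` that lies in the same apartments. -/
def IsJoinable (S : AffineHovel 𝔸 X) (γ : Filter X) : Prop :=
  ∃ K, (S.IsOfKind 𝔸.IsFacet K ∨ S.IsOfKind 𝔸.IsSolidChimneyGerm K) ∧ γ ≤ K ∧
    ∀ f, S.IsChart f → range f ∈ γ → range f ∈ K

theorem IsChart.isJoinable_pure (hf : S.IsChart f) (x : V) : S.IsJoinable (pure (f x)) := by
  refine ⟨map f (𝔸.facet x (𝔸.stdFacet univ)), .inl ⟨_, hf.range_mem_apts, f, hf.mem_isom_range, _,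
    ⟨x, _, 𝔸.isVFacet_stdFacet univ, rfl⟩, rfl⟩, ?_, fun g hg hx => ?_⟩
  · refine pure_le_iff.2 fun M ⟨Q, _, hQ, hQM⟩ => hQM (mem_of_mem_nhdsWithin ?_ hQ)
    exact ⟨0, zero_mem_stdFacet_univ, add_zero x⟩
  · obtain ⟨w, -, Q, hQ, hxQ, heq⟩ := hf.exists_eqOn_of_point hg hx
    exact mem_map.2 (mem_of_superset (hQ.mem_facet hxQ) (subset_preimage_range_of_eqOn heq))

theorem IsJoinable.exists_isChart {γ : Filter X} (hγ : S.IsJoinable γ) (hf : S.IsChart f)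
    {F₀ : Set V} (hF₀ : 𝔸.IsVFacet F₀) (hF : 𝔸.IsSphericalVFacet F) (x : V) :
    ∃ g, S.IsChart g ∧ range g ∈ map f (𝔸.chimneyGerm x F₀ F) ∧ range g ∈ γ := by
  obtain ⟨K, hK, hγK, -⟩ := hγ
  obtain ⟨A, hA, hAF, hAK⟩ := S.ma3 _ K ⟨_, hf.range_mem_apts, f, hf.mem_isom_range, _,
    isSplayedChimneyGerm hF₀ hF x, rfl⟩ hK
  obtain ⟨g, hg, rfl⟩ := exists_isChart_range_eq hA
  exact ⟨g, hg, hAF, hγK hAK⟩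

end Charts

section SharedSectorFaces

variable {V ι : Type*} [NormedAddCommGroup V] [NormedSpace ℝ V] [FiniteDimensional ℝ V]
  [Fintype ι] {𝔸 : Apartment V ι} {X : Type*} {S : AffineHovel 𝔸 X} {f g : V → X} {F : Set V}
  {x : V}

theorem IsChart.apply_mem_range_of_pos (hf : S.IsChart f) (hg : S.IsChart g)
    (hF : 𝔸.IsVFacet F) {ζ : V} (hζ : ζ ∈ F) (h : ∀ t : ℝ, 0 < t → f (x + t • ζ) ∈ range g) :
    f x ∈ range g := by
  rcases eq_or_ne ζ 0 with rfl | hζ0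
  · simpa using h 1 one_pos
  obtain ⟨w, -, Q, hQ, hxQ, heq⟩ := hf.exists_eqOn_of_ma2 hg
    (.inr (.inl ⟨x, ζ, hζ0, hF.mem_titsCone_or_neg_mem hζ, rfl⟩))
    (mem_map.2 (mem_of_superset self_mem_nhdsWithin (image_subset_iff.2 fun t ht => h t ht.1)))
  have hlim := tendsto_add_smul_nhdsGT x ζ
  refine subset_preimage_range_of_eqOn heq (hQ.isClosed.mem_of_tendsto hlim ?_)
  exact (tendsto_nhdsWithin_iff.2 ⟨hlim, mem_of_superset (Ioc_mem_nhdsGT one_pos)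
    fun t ht => mem_image_of_mem _ ht⟩).eventually hxQ

theorem IsChart.exists_eqOn_closure (hf : S.IsChart f) (hg : S.IsChart g)
    (hF : 𝔸.IsSphericalVFacet F) (h : f '' (x +ᵥ F) ⊆ range g) :
    ∃ w ∈ 𝔸.W, EqOn (g ∘ w) f (x +ᵥ closure F) := by
  obtain ⟨ζ, hζ⟩ := hF.isVFacet.nonempty
  have hpos (t : ℝ) (ht : 0 < t) : f (x + t • ζ) ∈ range g :=
    h ⟨_, ⟨t • ζ, hF.isVFacet.smul_mem hζ ht, rfl⟩, rfl⟩
  obtain ⟨w, hw, Q, hQ, hxQ, heq⟩ := hf.exists_eqOn_of_halfLine hg hF hζ (x := x) fun t ht => by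
    rcases ht.eq_or_lt with rfl | ht
    · simpa using hf.apply_mem_range_of_pos hg hF.isVFacet hζ hpos
    · exact hpos t ht
  refine ⟨w, hw, heq.mono ?_⟩
  rintro _ ⟨c, hc, rfl⟩
  exact hQ.add_mem hF.isVFacet hζ hxQ (by simpa using hxQ 0 le_rfl) hc

theorem IsChart.range_mem_map_chimneyGerm (hf : S.IsChart f) (hg : S.IsChart g)
    (hF : 𝔸.IsSphericalVFacet F) (h : range g ∈ map f (sectorFaceGerm x F)) :
    range g ∈ map f (𝔸.chimneyGerm x (𝔸.stdFacet univ) F) := by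
  obtain ⟨ξ, hξ, hsub⟩ := (mem_sectorFaceGerm hF.isVFacet).1 h
  obtain ⟨ζ, hζ⟩ := hF.isVFacet.nonempty
  obtain ⟨w, -, Q, hQ, hxQ, heq⟩ := hf.exists_eqOn_of_halfLine hg hF hζ (x := x + (ξ + ζ)) <| by
      refine fun t ht => hsub ⟨(1 + t) • ζ, hF.isVFacet.smul_mem hζ (by linarith), ?_⟩
      simp only [vadd_eq_add]
      module
  exact mem_map.2 (mem_of_superset (hQ.mem_chimneyGerm hF
    (hF.isVFacet.add_mem_closure hξ (subset_closure hζ)) hζ hxQ)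
    (subset_preimage_range_of_eqOn heq))

theorem IsChart.isJoinable_germ (hf : S.IsChart f) (hF : 𝔸.IsSphericalVFacet F) (x : V) :
    S.IsJoinable (map f (sectorFaceGerm x F)) :=
  have h₀ := 𝔸.isVFacet_stdFacet univ
  ⟨map f (𝔸.chimneyGerm x (𝔸.stdFacet univ) F), .inr ⟨_, hf.range_mem_apts, f, hf.mem_isom_range,
    _, isSolidChimneyGerm h₀ hF x, rfl⟩, map_mono (sectorFaceGerm_le_chimneyGerm x h₀),
    fun _ hg => hf.range_mem_map_chimneyGerm hg hF⟩

theorem IsJoinable.exists_eqOn {γ : Filter X} (hγ : S.IsJoinable γ) (hf : S.IsChart f)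
    (hg : S.IsChart g) (hF : 𝔸.IsSphericalVFacet F) (hgx : range g ∈ map f (sectorFaceGerm x F))
    (hfγ : range f ∈ γ) (hgγ : range g ∈ γ) :
    ∃ w ∈ 𝔸.W, ∃ Q, 𝔸.IsEnclosed Q ∧ Q ∈ sectorFaceGerm x F ∧ Q ∈ comap f γ ∧
      EqOn (g ∘ w) f Q := by
  obtain ⟨K, hK, hγK, hrange⟩ := hγ
  have h₀ := 𝔸.isVFacet_stdFacet univ
  obtain ⟨w, hw, Q, hQ, hQm, heq⟩ := hf.exists_eqOn_of_sharesEnclosure hg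
    (S.ma4 _ K ⟨_, hf.range_mem_apts, f, hf.mem_isom_range, _, isSplayedChimneyGerm h₀ hF x, rfl⟩
      hK _ hf.range_mem_apts _ hg.range_mem_apts range_mem_map (hrange f hf hfγ)
      (hf.range_mem_map_chimneyGerm hg hF hgx) (hrange g hg hgγ))
  rw [comap_sup, comap_map hf.injective, mem_sup] at hQm
  exact ⟨w, hw, Q, hQ, sectorFaceGerm_le_chimneyGerm x h₀ hQm.1, comap_mono hγK hQm.2, heq⟩

end SharedSectorFaces

end AffineHovel

namespace Apartment

section ChimneyGerm

variable {V ι : Type*} [NormedAddCommGroup V] [NormedSpace ℝ V] [FiniteDimensional ℝ V]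
  [Fintype ι] {𝔸 : Apartment V ι} {F₀ F M : Set V} {x v : V}

theorem eventually_mem_sectorFaceGerm (hF₀ : 𝔸.IsVFacet F₀) (hF : 𝔸.IsVFacet F) (hv : v ∈ F₀)
    (hM : M ∈ 𝔸.chimneyGerm x F₀ F) : ∀ᶠ t : ℝ in 𝓝[>] 0, M ∈ sectorFaceGerm (x + t • v) F := by
  obtain ⟨ξ, hξ, Q, -, hQ, hQM⟩ := exists_mem_cl_of_mem_chimneyGerm hF hM
  obtain ⟨T, ⟨Q', -, hQ', hQT⟩, U, hU, hTU⟩ := Filter.mem_add.1 hQ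
  have hlim : Tendsto (fun t : ℝ => x + t • v) (𝓝[>] 0) (𝓝[x +ᵥ F₀] x) :=
    tendsto_nhdsWithin_iff.2 ⟨tendsto_add_smul_nhdsGT x v, mem_of_superset self_mem_nhdsWithin
      fun t ht => vadd_mem_vadd_set (hF₀.smul_mem hv ht)⟩
  filter_upwards [hlim hQ'] with t ht
  refine (mem_sectorFaceGerm hF).2 ⟨ξ, hξ, ?_⟩
  rintro _ ⟨u, hu, rfl⟩
  refine hQM (hTU ⟨_, hQT ht, ξ + u, hU ⟨u, hu, rfl⟩, ?_⟩)
  simp only [vadd_eq_add, add_assoc]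

end ChimneyGerm

end Apartment

namespace AffineHovel

open SimpleRoots Apartment

/-! ### Moving a sector face parallel to itself -/

theorem isLocallyConstant_of_eventually_eq {α : Type*} {q : ℝ → α}
    (hright : ∀ s, ∀ᶠ t in 𝓝[>] 0, q (s + t) = q s)
    (hleft : ∀ s, ∀ᶠ t in 𝓝[>] 0, q (s - t) = q s) : IsLocallyConstant q := by
  refine (IsLocallyConstant.iff_eventually_eq q).2 fun s => ?_
  have hLT := map_subLeft_nhdsGT (c := s) (a := 0)
  have hGT := map_add_left_nhdsGT (c := s) (a := 0)
  rw [sub_zero] at hLT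
  rw [add_zero] at hGT
  rw [← nhdsNE_sup_pure, ← nhdsLT_sup_nhdsGT, ← hLT, ← hGT]
  exact eventually_sup.2 ⟨eventually_sup.2 ⟨hleft s, hright s⟩, eventually_pure.2 rfl⟩

section ParallelThrough

variable {V ι : Type*} [NormedAddCommGroup V] [NormedSpace ℝ V] [Fintype ι] {𝔸 : Apartment V ι}
  {X : Type*} {S : AffineHovel 𝔸 X} {f : V → X} {F : Set V} {γ : Filter X}

/-- Some apartment that contains `γ` contains parallel sector faces with the germs `α` and `β`. -/
def ParallelThrough (S : AffineHovel 𝔸 X) (γ α β : Filter X) : Prop :=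
  ∃ f, S.IsChart f ∧ range f ∈ γ ∧ ∃ x y F, 𝔸.IsSphericalVFacet F ∧
    α = map f (sectorFaceGerm x F) ∧ β = map f (sectorFaceGerm y F)

theorem ParallelThrough.symm {α β : Filter X} (h : S.ParallelThrough γ α β) :
    S.ParallelThrough γ β α := by
  obtain ⟨f, hf, hfγ, x, y, F, hF, hα, hβ⟩ := h
  exact ⟨f, hf, hfγ, y, x, F, hF, hβ, hα⟩

variable [FiniteDimensional ℝ V]

namespace IsJoinable

/-- An apartment that contains `γ` and the germ of the chimney of direction `F` based at the facet
`F(p, F₀)` also contains the germs of the nearby sector faces `p + t v + F`. -/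
theorem eventually_parallelThrough (hγ : S.IsJoinable γ) (hf : S.IsChart f)
    (hF : 𝔸.IsSphericalVFacet F) {F₀ : Set V} (hF₀ : 𝔸.IsVFacet F₀) {v : V} (hv : v ∈ F₀) (p : V) :
    ∀ᶠ t : ℝ in 𝓝[>] 0, S.ParallelThrough γ (map f (sectorFaceGerm (p + t • v) F))
      (map f (sectorFaceGerm p F)) := by
  obtain ⟨g, hg, hgp, hgγ⟩ := hγ.exists_isChart hf hF₀ hF p
  filter_upwards [eventually_mem_sectorFaceGerm hF₀ hF.isVFacet hv hgp] with t hgt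
  obtain ⟨w, hw, Q, -, hQp, hQt, heq⟩ := (hf.isJoinable_germ hF (p + t • v)).exists_eqOn hf hg hF
    (map_mono (sectorFaceGerm_le_chimneyGerm p hF₀) hgp) range_mem_map hgt
  rw [comap_map hf.injective] at hQt
  exact ⟨g ∘ w, hg.comp hw, by rwa [EquivLike.range_comp], _, _, F, hF,
    map_congr (mem_of_superset hQt heq.symm), map_congr (mem_of_superset hQp heq.symm)⟩

theorem quot_mk_germ_add (hγ : S.IsJoinable γ) (hf : S.IsChart f) (hF : 𝔸.IsSphericalVFacet F)
    {F₀ : Set V} (hF₀ : 𝔸.IsVFacet F₀) {v : V} (hv : v ∈ F₀) (p : V) :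
    Quot.mk (S.ParallelThrough γ) (map f (sectorFaceGerm (p + v) F)) =
      Quot.mk _ (map f (sectorFaceGerm p F)) := by
  let q (t : ℝ) : Quot (S.ParallelThrough γ) :=
    Quot.mk _ (map f (sectorFaceGerm (p + t • v) F))
  have hloc : IsLocallyConstant q := by
    refine isLocallyConstant_of_eventually_eq (fun s => ?_) fun s => ?_
    · filter_upwards [hγ.eventually_parallelThrough hf hF hF₀ hv (p + s • v)] with t ht
      simpa only [q, add_smul, add_assoc] using Quot.sound ht
    · filter_upwards [hγ.eventually_parallelThrough hf hF hF₀.neg (neg_mem_neg.2 hv) (p + s • v)]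
        with t ht
      have hshift : p + s • v + t • -v = p + (s - t) • v := by module
      rw [hshift] at ht
      exact Quot.sound ht
  simpa [q] using hloc.apply_eq_of_preconnectedSpace 1 0

theorem quot_mk_germ_eq (hγ : S.IsJoinable γ) (hf : S.IsChart f) (hF : 𝔸.IsSphericalVFacet F)
    (x y : V) : Quot.mk (S.ParallelThrough γ) (map f (sectorFaceGerm x F)) =
      Quot.mk _ (map f (sectorFaceGerm y F)) := by
  obtain ⟨ζ, hζ⟩ := hF.isVFacet.nonempty
  obtain ⟨s, ⟨F₀, hF₀, hs⟩, hs0⟩ :=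
    (((tendsto_add_smul_nhdsGT ζ (y - x)).eventually (hF.eventually_mem_facet hζ)).and
      self_mem_nhdsWithin).exists
  have hs0 : 0 < s := hs0
  have hshift : x + s⁻¹ • (ζ + s • (y - x)) = y + s⁻¹ • ζ := by
    rw [smul_add, inv_smul_smul₀ hs0.ne']
    abel
  rw [← hγ.quot_mk_germ_add hf hF hF₀ (hF₀.smul_mem hs (inv_pos.2 hs0)) x, hshift,
    sectorFaceGerm_add hF.isVFacet y (subset_closure (hF.isVFacet.smul_mem hζ (inv_pos.2 hs0)))]

theorem apply_germ_of_apply_germ (hγ : S.IsJoinable γ) {Φ : Filter X → Prop}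
    (hΦ : ∀ α β, S.ParallelThrough γ α β → Φ α → Φ β) (hf : S.IsChart f)
    (hF : 𝔸.IsSphericalVFacet F) {x : V} (y : V) (h : Φ (map f (sectorFaceGerm x F))) :
    Φ (map f (sectorFaceGerm y F)) := by
  let Φ' : Quot (S.ParallelThrough γ) → Prop :=
    Quot.lift Φ fun α β h => propext ⟨hΦ α β h, hΦ β α h.symm⟩
  exact (congrArg Φ' (hγ.quot_mk_germ_eq hf hF x y)).mp h

end IsJoinable

end ParallelThrough

/-! ### Relative position of germs -/

section HasDirections

variable {V ι : Type*} [NormedAddCommGroup V] [NormedSpace ℝ V] [Fintype ι] {𝔸 : Apartment V ι}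
  {X : Type*} {S : AffineHovel 𝔸 X} {f g : V → X} {F F' G G' : Set V} {x : V} {γ δ : Filter X}

/-- The relative position of two germs: `F` and `G` are their directions in some chart of an
apartment that contains both. -/
def HasDirections (S : AffineHovel 𝔸 X) (γ δ : Filter X) (F G : Set V) : Prop :=
  𝔸.IsSphericalVFacet F ∧ 𝔸.IsSphericalVFacet G ∧ ∃ f, S.IsChart f ∧ ∃ x y,
    γ = map f (sectorFaceGerm x F) ∧ δ = map f (sectorFaceGerm y G)

theorem HasDirections.symm (h : S.HasDirections γ δ F G) : S.HasDirections δ γ G F := by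
  obtain ⟨hF, hG, f, hf, x, y, hγ, hδ⟩ := h
  exact ⟨hG, hF, f, hf, y, x, hδ, hγ⟩

variable [FiniteDimensional ℝ V]

theorem map_sectorFaceGerm_congr (hF : 𝔸.IsVFacet F) (h : EqOn f g (x +ᵥ F)) :
    map f (sectorFaceGerm x F) = map g (sectorFaceGerm x F) :=
  map_congr (mem_of_superset (vadd_mem_sectorFaceGerm hF x) h)

theorem IsChart.exists_eqOn_of_mem_germ (hf : S.IsChart f) (hg : S.IsChart g)
    (hF : 𝔸.IsSphericalVFacet F) (h : range g ∈ map f (sectorFaceGerm x F)) :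
    ∃ w ∈ 𝔸.W, ∃ p, sectorFaceGerm p F = sectorFaceGerm x F ∧
      EqOn (g ∘ w) f (p +ᵥ closure F) := by
  obtain ⟨ξ, hξ, hsub⟩ := (mem_sectorFaceGerm hF.isVFacet).1 h
  obtain ⟨w, hw, heq⟩ := hf.exists_eqOn_closure hg hF (image_subset_iff.2 hsub)
  exact ⟨w, hw, x + ξ, sectorFaceGerm_add hF.isVFacet x hξ, heq⟩

theorem IsChart.exists_germ_eq (hf : S.IsChart f) (hg : S.IsChart g)
    (hF : 𝔸.IsSphericalVFacet F) (h : range g ∈ map f (sectorFaceGerm x F)) :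
    ∃ y G, 𝔸.IsSphericalVFacet G ∧ map f (sectorFaceGerm x F) = map g (sectorFaceGerm y G) := by
  obtain ⟨w, hw, p, hp, heq⟩ := hf.exists_eqOn_of_mem_germ hg hF h
  refine ⟨w p, w.linear '' F, hF.image (Wv_le_signedWv (linear_mem_Wv hw)), ?_⟩
  rw [← hp, ← map_comp_sectorFaceGerm hw hF,
    map_sectorFaceGerm_congr hF.isVFacet (heq.mono (vadd_set_mono subset_closure))]

theorem IsChart.exists_hasDirections (hf : S.IsChart f) (hg : S.IsChart g)
    (hF : 𝔸.IsSphericalVFacet F) (hG : 𝔸.IsSphericalVFacet G) (x y : V) :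
    ∃ F' G', S.HasDirections (map f (sectorFaceGerm x F)) (map g (sectorFaceGerm y G)) F' G' := by
  have h₀ := 𝔸.isVFacet_stdFacet univ
  obtain ⟨k, hk, hkF, hkG⟩ := (hg.isJoinable_germ hG y).exists_isChart hf h₀ hF x
  obtain ⟨x', F', hF', hx⟩ := hf.exists_germ_eq hk hF
    (map_mono (sectorFaceGerm_le_chimneyGerm x h₀) hkF)
  obtain ⟨y', G', hG', hy⟩ := hg.exists_germ_eq hk hG hkG
  exact ⟨F', G', hF', hG', k, hk, x', y', hx, hy⟩

namespace HasDirections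

theorem exists_germ_eq (h : S.HasDirections γ δ F G) (hg : S.IsChart g) (hgγ : range g ∈ γ)
    (hgδ : range g ∈ δ) : ∃ w ∈ 𝔸.W, ∃ x y,
      γ = map (g ∘ w) (sectorFaceGerm x F) ∧ δ = map (g ∘ w) (sectorFaceGerm y G) := by
  obtain ⟨hF, hG, f, hf, x, y, rfl, rfl⟩ := h
  obtain ⟨w, hw, Q, -, hQx, hQy, heq⟩ := (hf.isJoinable_germ hG y).exists_eqOn hf hg hF hgγ
    range_mem_map hgδ
  rw [comap_map hf.injective] at hQy
  exact ⟨w, hw, x, y, map_congr (mem_of_superset hQx heq.symm),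
    map_congr (mem_of_superset hQy heq.symm)⟩

theorem exists_weyl (h : S.HasDirections γ δ F G) (h' : S.HasDirections γ δ F' G') :
    ∃ w ∈ 𝔸.Wv, F' = w '' F ∧ G' = w '' G := by
  obtain ⟨hF', hG', f, hf, x', y', rfl, rfl⟩ := h'
  obtain ⟨w, hw, x, y, hx, hy⟩ := h.exists_germ_eq hf range_mem_map range_mem_map
  have hw' := Wv_le_signedWv (linear_mem_Wv hw)
  rw [map_comp_sectorFaceGerm hw h.1] at hx
  rw [map_comp_sectorFaceGerm hw h.2.1] at hy
  exact ⟨w.linear, linear_mem_Wv hw, hf.direction_eq hF' (h.1.image hw') hx,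
    hf.direction_eq hG' (h.2.1.image hw') hy⟩

theorem of_parallelThrough {γ' : Filter X} (hγ : S.ParallelThrough δ γ γ')
    (h : S.HasDirections γ δ F G) : S.HasDirections γ' δ F G := by
  obtain ⟨g, hg, hgδ, p, p', H, hH, rfl, rfl⟩ := hγ
  obtain ⟨w, hw, a, b, ha, hb⟩ := h.exists_germ_eq hg range_mem_map hgδ
  rw [map_comp_sectorFaceGerm hw h.1] at ha
  obtain rfl := hg.direction_eq hH (h.1.image (Wv_le_signedWv (linear_mem_Wv hw))) ha
  refine ⟨h.1, h.2.1, g ∘ w, hg.comp hw, w.symm p', b, ?_, hb⟩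
  rw [map_comp_sectorFaceGerm hw h.1, AffineEquiv.apply_symm_apply]

theorem of_parallel {γ' : Filter X} {E : Set V} (hγ : S.HasDirections γ γ' E E)
    (h : S.HasDirections γ δ F G) : S.HasDirections γ' δ F G := by
  have hδ : S.IsJoinable δ := by
    obtain ⟨-, hG, f, hf, -, y, -, rfl⟩ := h
    exact hf.isJoinable_germ hG y
  obtain ⟨hE, -, f, hf, x, x', rfl, rfl⟩ := hγ
  exact hδ.apply_germ_of_apply_germ (fun _ _ => of_parallelThrough) hf hE x' h

end HasDirections

end HasDirections

/-! ### Spherical sector faces -/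

section Presents

variable {V ι : Type*} [NormedAddCommGroup V] [NormedSpace ℝ V] [FiniteDimensional ℝ V]
  [Fintype ι] {𝔸 : Apartment V ι} {X : Type*} {S : AffineHovel 𝔸 X} {s : Set X} {f g : V → X}
  {x y : V} {F G : Set V}

namespace Presents

theorem exists_weyl (hs : S.Presents s f x F) (hs' : S.Presents s g y G) :
    ∃ w ∈ 𝔸.W, EqOn (g ∘ w) f (x +ᵥ closure F) ∧ w x +ᵥ w.linear '' F = y +ᵥ G := by
  obtain ⟨hf, hF, rfl⟩ := hs
  obtain ⟨hg, -, hs⟩ := hs'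
  obtain ⟨w, hw, heq⟩ := hf.exists_eqOn_closure hg hF (hs.trans_subset (image_subset_range _ _))
  refine ⟨w, hw, heq, hg.injective.image_injective ?_⟩
  rw [← hs, ← affineEquiv_image_vadd, ← image_comp,
    (heq.mono (vadd_set_mono subset_closure)).image_eq]

theorem map_germ_eq (hs : S.Presents s f x F) (hs' : S.Presents s g y G) :
    map f (sectorFaceGerm x F) = map g (sectorFaceGerm y G) := by
  obtain ⟨w, hw, heq, himage⟩ := hs.exists_weyl hs'
  rw [← map_sectorFaceGerm_congr hs.2.1.isVFacet (heq.mono (vadd_set_mono subset_closure)),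
    map_comp_sectorFaceGerm hw hs.2.1, sectorFaceGerm_eq_of_vadd_eq
      (hs.2.1.image (Wv_le_signedWv (linear_mem_Wv hw))).isVFacet hs'.2.1.isVFacet himage]

theorem image_closure_eq (hs : S.Presents s f x F) (hs' : S.Presents s g y G) :
    f '' (x +ᵥ closure F) = g '' (y +ᵥ closure G) := by
  obtain ⟨w, -, heq, himage⟩ := hs.exists_weyl hs'
  rw [← heq.image_eq, image_comp, affineEquiv_image_vadd, image_closure_linearEquiv,
    vadd_closure_eq_of_vadd_eq himage]

end Presents

end Presents

namespace SphericalSectorFace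

variable {V ι : Type*} [NormedAddCommGroup V] [NormedSpace ℝ V] [Fintype ι] {𝔸 : Apartment V ι}
  {X : Type*} {S : AffineHovel 𝔸 X} {s s₁ t t₁ u : S.SphericalSectorFace} {f : V → X}
  {x : V} {F G : Set V}

theorem parallel_iff : s.Parallel t ↔ ∃ F, S.HasDirections s.germ t.germ F F :=
  ⟨fun ⟨f, hf, x, y, F, hF, hs, ht⟩ => ⟨F, hF, hF, f, hf, x, y, hs, ht⟩,
    fun ⟨F, hF, _, f, hf, x, y, hs, ht⟩ => ⟨f, hf, x, y, F, hF, hs, ht⟩⟩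

theorem dominates_iff :
    s.Dominates t ↔ ∃ F F', F' ⊆ _root_.closure F ∧ S.HasDirections s.germ t.germ F F' :=
  ⟨fun ⟨f, hf, x, y, F, F', hF, hF', h, hs, ht⟩ => ⟨F, F', h, hF, hF', f, hf, x, y, hs, ht⟩,
    fun ⟨F, F', h, hF, hF', f, hf, x, y, hs, ht⟩ => ⟨f, hf, x, y, F, F', hF, hF', h, hs, ht⟩⟩

theorem opposite_iff : s.Opposite t ↔ ∃ F, S.HasDirections s.germ t.germ F (-F) :=
  ⟨fun ⟨f, hf, x, y, F, hF, hs, ht⟩ => ⟨F, hF, hF.neg, f, hf, x, y, hs, ht⟩,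
    fun ⟨F, hF, _, f, hf, x, y, hs, ht⟩ => ⟨f, hf, x, y, F, hF, hs, ht⟩⟩

theorem Parallel.symm (h : s.Parallel t) : t.Parallel s := by
  obtain ⟨F, h⟩ := parallel_iff.1 h
  exact parallel_iff.2 ⟨F, h.symm⟩

theorem Parallel.dominates (h : s.Parallel t) : s.Dominates t := by
  obtain ⟨F, h⟩ := parallel_iff.1 h
  exact dominates_iff.2 ⟨F, F, subset_closure, h⟩

theorem Opposite.symm (h : s.Opposite t) : t.Opposite s := by
  obtain ⟨F, h⟩ := opposite_iff.1 h
  refine opposite_iff.2 ⟨-F, ?_⟩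
  rw [neg_neg]
  exact h.symm

/-- The sector face `x + F`, read in the chart `f`. -/
def ofChart (hf : S.IsChart f) (hF : 𝔸.IsSphericalVFacet F) (x : V) : S.SphericalSectorFace :=
  ⟨f '' (x +ᵥ F), f, x, F, hf, hF, rfl⟩

variable [FiniteDimensional ℝ V]

theorem germ_eq (h : S.Presents s.1 f x F) : s.germ = map f (sectorFaceGerm x F) :=
  le_antisymm (iInf_le_of_le f <| iInf_le_of_le x <| iInf_le_of_le F <| iInf_le _ h)
    (le_iInf fun _ => le_iInf fun _ => le_iInf fun _ => le_iInf fun h' => (h.map_germ_eq h').le)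

theorem closure_eq (h : S.Presents s.1 f x F) : s.closure = f '' (x +ᵥ _root_.closure F) :=
  Subset.antisymm (iUnion_subset fun _ => iUnion_subset fun _ => iUnion_subset fun _ =>
    iUnion_subset fun h' => (h.image_closure_eq h').ge)
    (subset_iUnion_of_subset f <| subset_iUnion_of_subset x <| subset_iUnion_of_subset F <|
      subset_iUnion_of_subset h subset_rfl)

theorem germ_ofChart (hf : S.IsChart f) (hF : 𝔸.IsSphericalVFacet F) (x : V) :
    (ofChart hf hF x).germ = map f (sectorFaceGerm x F) :=
  germ_eq ⟨hf, hF, rfl⟩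

theorem closure_ofChart (hf : S.IsChart f) (hF : 𝔸.IsSphericalVFacet F) (x : V) :
    (ofChart hf hF x).closure = f '' (x +ᵥ _root_.closure F) :=
  closure_eq ⟨hf, hF, rfl⟩

theorem exists_hasDirections (s u : S.SphericalSectorFace) :
    ∃ F G, S.HasDirections s.germ u.germ F G := by
  obtain ⟨f, x, F, hs⟩ := s.2
  obtain ⟨g, y, G, hu⟩ := u.2
  rw [germ_eq hs, germ_eq hu]
  exact hs.1.exists_hasDirections hu.1 hs.2.1 hu.2.1 x y

/-! ### Parallelism and dominance -/

theorem Parallel.refl (s : S.SphericalSectorFace) : s.Parallel s := by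
  obtain ⟨f, x, F, h⟩ := s.2
  exact ⟨f, h.1, x, x, F, h.2.1, germ_eq h, germ_eq h⟩

theorem Parallel.hasDirections (hst : s.Parallel t) (h : S.HasDirections s.germ u.germ F G) :
    S.HasDirections t.germ u.germ F G := by
  obtain ⟨E, hE⟩ := parallel_iff.1 hst
  exact .of_parallel hE h

theorem Parallel.hasDirections₂ (hs : s₁.Parallel s) (ht : t.Parallel t₁)
    (h : S.HasDirections s.germ t.germ F G) : S.HasDirections s₁.germ t₁.germ F G :=
  (ht.hasDirections (hs.symm.hasDirections h).symm).symm

theorem Parallel.trans (h : s.Parallel t) (h' : t.Parallel u) : s.Parallel u := by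
  obtain ⟨F, h'⟩ := parallel_iff.1 h'
  exact parallel_iff.2 ⟨F, h.symm.hasDirections h'⟩

theorem Dominates.of_parallel (hs : s₁.Parallel s) (h : s.Dominates t) (ht : t.Parallel t₁) :
    s₁.Dominates t₁ := by
  obtain ⟨F, F', hsub, h⟩ := dominates_iff.1 h
  exact dominates_iff.2 ⟨F, F', hsub, hs.hasDirections₂ ht h⟩

theorem Dominates.exists_face (h : s.Dominates t) (hf : S.IsChart f)
    (hF : 𝔸.IsSphericalVFacet F) (hs : s.germ = map f (sectorFaceGerm x F)) :
    ∃ (F' : Set V) (hF' : 𝔸.IsSphericalVFacet F'), F' ⊆ _root_.closure F ∧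
      ∀ y, t.Parallel (ofChart hf hF' y) := by
  obtain ⟨g, hg, a, b, E, E', hE, hE', hsub, hsE, htE⟩ := h
  obtain ⟨w, hw, p, hp, heq⟩ := hg.exists_eqOn_of_mem_germ hf hE
    (by rw [← hsE, hs]; exact range_mem_map)
  have hread {H : Set V} (hH : 𝔸.IsSphericalVFacet H) (hHE : H ⊆ _root_.closure E) :
      map g (sectorFaceGerm p H) = map f (sectorFaceGerm (w p) (w.linear '' H)) := by
    rw [← map_comp_sectorFaceGerm hw hH,
      map_sectorFaceGerm_congr hH.isVFacet (heq.mono (vadd_set_mono hHE))]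
  have hw' := Wv_le_signedWv (linear_mem_Wv hw)
  obtain rfl : F = w.linear '' E := hf.direction_eq hF (hE.image hw') <| by
    rw [← hs, hsE, ← hp, hread hE subset_closure]
  have htp : t.Parallel (ofChart hg hE' p) := ⟨g, hg, b, p, E', hE', htE, germ_ofChart _ _ _⟩
  refine ⟨_, hE'.image hw', ?_, fun y => htp.trans ⟨f, hf, w p, y, _, hE'.image hw', ?_, ?_⟩⟩
  · rw [← image_closure_linearEquiv]
    exact image_mono hsub
  · rw [germ_ofChart, hread hE' hsub]
  · exact germ_ofChart _ _ _

theorem Dominates.hasDirections (h : s.Dominates t) (hd : S.HasDirections s.germ u.germ F G) :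
    ∃ F', F' ⊆ _root_.closure F ∧ S.HasDirections t.germ u.germ F' G := by
  obtain ⟨hF, hG, f, hf, x, y, hs, hu⟩ := hd
  obtain ⟨F', hF', hsub, hp⟩ := h.exists_face hf hF hs
  exact ⟨F', hsub, (hp x).symm.hasDirections ⟨hF', hG, f, hf, x, y, germ_ofChart _ _ _, hu⟩⟩

theorem Dominates.trans (h : s.Dominates t) (h' : t.Dominates u) : s.Dominates u := by
  obtain ⟨F, F', hsub, hd⟩ := dominates_iff.1 h
  obtain ⟨F'', hsub', hd'⟩ := h'.hasDirections hd.symm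
  exact dominates_iff.2 ⟨F, F'', hsub'.trans (closure_minimal hsub isClosed_closure), hd'.symm⟩

theorem parallel_of_dominates (h : s.Dominates t) (h' : t.Dominates s) : s.Parallel t := by
  obtain ⟨F, F', hsub, hd⟩ := dominates_iff.1 h
  obtain ⟨G, G', hsub', hd'⟩ := dominates_iff.1 h'
  obtain ⟨w, -, rfl, rfl⟩ := hd.exists_weyl hd'.symm
  rw [← image_closure_linearEquiv, image_subset_image_iff w.injective] at hsub'
  obtain rfl := facet_eq_of_subset_closure hd.1.isVFacet hd.2.1.isVFacet hsub' hsub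
  exact parallel_iff.2 ⟨F, hd⟩

theorem parallel_iff_dominates : s.Parallel t ↔ s.Dominates t ∧ t.Dominates s :=
  ⟨fun h => ⟨h.dominates, h.symm.dominates⟩, fun h => parallel_of_dominates h.1 h.2⟩

theorem dominates_of_subset_closure (h : t.1 ⊆ s.closure) : s.Dominates t := by
  obtain ⟨f, x, F, hs⟩ := s.2
  obtain ⟨g, y, G, ht⟩ := t.2
  have hsgerm := germ_eq hs
  have htgerm := germ_eq ht
  rw [closure_eq hs, ht.2.2] at h
  obtain ⟨⟨hf, hF, -⟩, hg, hG, -⟩ := And.intro hs ht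
  obtain ⟨w, hw, heq⟩ := hg.exists_eqOn_closure hf hG (h.trans (image_subset_range _ _))
  have hwG := hG.image (Wv_le_signedWv (linear_mem_Wv hw))
  replace heq : EqOn (f ∘ w) g (y +ᵥ G) := heq.mono (vadd_set_mono subset_closure)
  rw [← heq.image_eq, image_comp, image_subset_image_iff hf.injective, affineEquiv_image_vadd] at h
  refine ⟨f, hf, x, w y, F, _, hF, hwG,
    subset_closure_of_vadd_subset hF.isVFacet hwG.isVFacet h, hsgerm, ?_⟩
  rw [htgerm, ← map_comp_sectorFaceGerm hw hG, map_sectorFaceGerm_congr hG.isVFacet heq]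

theorem Dominates.exists_parallel_subset (h : s.Dominates t) :
    ∃ t₁ : S.SphericalSectorFace, t₁.Parallel t ∧ t₁.1 ⊆ s.closure := by
  obtain ⟨f, x, F, hs⟩ := s.2
  obtain ⟨F', hF', hsub, hpar⟩ := h.exists_face hs.1 hs.2.1 (germ_eq hs)
  refine ⟨_, (hpar x).symm, ?_⟩
  rw [closure_eq hs]
  exact image_mono (vadd_set_mono hsub)

theorem dominates_iff_exists_parallel_subset : s.Dominates t ↔
    ∃ t₁ : S.SphericalSectorFace, t₁.Parallel t ∧ t₁.1 ⊆ s.closure :=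
  ⟨Dominates.exists_parallel_subset, fun ⟨_, h, hsub⟩ =>
    (dominates_of_subset_closure hsub).of_parallel (.refl s) h⟩

end SphericalSectorFace

/-! ### The sector face with given base point in a parallelism class -/

section ParallelFrom

variable {V ι : Type*} [NormedAddCommGroup V] [NormedSpace ℝ V] [Fintype ι] {𝔸 : Apartment V ι}
  {X : Type*} {S : AffineHovel 𝔸 X} {s : Set X} {f : V → X} {a p : V} {F : Set V}
  {γ γ' : Filter X} {z : X}

/-- In some apartment, `s` is the sector face with base point `z` parallel to a sector face of
germ `γ`. -/
def IsParallelFrom (S : AffineHovel 𝔸 X) (z : X) (s : Set X) (γ : Filter X) : Prop :=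
  ∃ f, S.IsChart f ∧ ∃ a p F, 𝔸.IsSphericalVFacet F ∧ f a = z ∧ s = f '' (a +ᵥ F) ∧
    γ = map f (sectorFaceGerm p F)

variable [FiniteDimensional ℝ V]

namespace IsParallelFrom

theorem eq_image (h : S.IsParallelFrom (f a) s (map f (sectorFaceGerm p F))) (hf : S.IsChart f)
    (hF : 𝔸.IsSphericalVFacet F) : s = f '' (a +ᵥ F) := by
  obtain ⟨g, hg, b, q, G, hG, hgb, rfl, hgerm⟩ := h
  obtain ⟨w, hw, Q, hQ, hQq, hQb, heq⟩ := (hf.isJoinable_pure a).exists_eqOn hg hf hG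
    (hgerm ▸ range_mem_map) ⟨b, hgb⟩ (mem_range_self a)
  rw [← hgb, ← map_pure, comap_map hg.injective] at hQb
  have hwb : w b = a := hf.injective ((heq hQb).trans hgb)
  have hFG : F = w.linear '' G := by
    refine hf.direction_eq hF (hG.image (Wv_le_signedWv (linear_mem_Wv hw))) (x := p) (y := w q) ?_
    rw [hgerm, ← map_comp_sectorFaceGerm hw hG, map_congr (mem_of_superset hQq heq)]
  have hQG : b +ᵥ G ⊆ Q := by
    rintro _ ⟨c, hc, rfl⟩
    exact hQ.add_mem_of_mem_germ hG.isVFacet hQq hQb (subset_closure hc)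
  rw [← (heq.mono hQG).image_eq, image_comp, affineEquiv_image_vadd, hwb, hFG]

theorem of_parallelThrough (hγ : S.ParallelThrough (pure z) γ γ')
    (h : S.IsParallelFrom z s γ) : S.IsParallelFrom z s γ' := by
  obtain ⟨f, hf, ⟨a, rfl⟩, p, p', F, hF, rfl, rfl⟩ := hγ
  exact ⟨f, hf, a, p', F, hF, rfl, h.eq_image hf hF, rfl⟩

theorem of_hasDirections {E : Set V} (h : S.IsParallelFrom z s γ)
    (hγ : S.HasDirections γ γ' E E) : S.IsParallelFrom z s γ' := by
  have hz : S.IsJoinable (pure z) := by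
    obtain ⟨g, hg, a, -, -, -, rfl, -, -⟩ := h
    exact hg.isJoinable_pure a
  obtain ⟨hE, -, f, hf, x, y, rfl, rfl⟩ := hγ
  exact hz.apply_germ_of_apply_germ (fun _ _ => of_parallelThrough) hf hE y h

end IsParallelFrom

end ParallelFrom

namespace SphericalSectorFace

variable {V ι : Type*} [NormedAddCommGroup V] [NormedSpace ℝ V] [FiniteDimensional ℝ V]
  [Fintype ι] {𝔸 : Apartment V ι} {X : Type*} {S : AffineHovel 𝔸 X}
  {s s₁ t t₁ : S.SphericalSectorFace} {f g : V → X} {x y : V} {F G : Set V}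

theorem Parallel.eq_image (hs : S.Presents s.1 g y G) (hf : S.IsChart f)
    (hF : 𝔸.IsSphericalVFacet F) (hx : f x = g y) (h : s.Parallel (ofChart hf hF x)) :
    s.1 = f '' (x +ᵥ F) := by
  obtain ⟨E, hE⟩ := parallel_iff.1 h
  have hsy : S.IsParallelFrom (g y) s.1 s.germ :=
    ⟨g, hs.1, y, y, G, hs.2.1, rfl, hs.2.2, germ_eq hs⟩
  have hsx := hsy.of_hasDirections hE
  rw [← hx, germ_ofChart] at hsx
  exact hsx.eq_image hf hF

theorem Dominates.exists_parallel_superset (h : s.Dominates t) :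
    ∃ s₁ : S.SphericalSectorFace, s₁.Parallel s ∧ t.1 ⊆ s₁.closure := by
  obtain ⟨f, x, F, hs⟩ := s.2
  obtain ⟨g, y, G, ht⟩ := t.2
  have h₀ := 𝔸.isVFacet_stdFacet univ
  obtain ⟨k, hk, hkF, b, hb⟩ := (ht.1.isJoinable_pure y).exists_isChart hs.1 h₀ hs.2.1 x
  obtain ⟨p, E, hE, hp⟩ := hs.1.exists_germ_eq hk hs.2.1
    (map_mono (sectorFaceGerm_le_chimneyGerm x h₀) hkF)
  replace hp := (germ_eq hs).trans hp
  obtain ⟨E', hE', hsub, hpar⟩ := h.exists_face hk hE hp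
  refine ⟨ofChart hk hE b, ⟨k, hk, b, p, E, hE, germ_ofChart _ _ _, hp⟩, ?_⟩
  rw [closure_ofChart, (hpar b).eq_image ht hk hE' hb]
  exact image_mono (vadd_set_mono hsub)

theorem dominates_iff_exists_parallel_superset : s.Dominates t ↔
    ∃ s₁ : S.SphericalSectorFace, s₁.Parallel s ∧ t.1 ⊆ s₁.closure :=
  ⟨Dominates.exists_parallel_superset, fun ⟨_, h, hsub⟩ =>
    (dominates_of_subset_closure hsub).of_parallel h.symm (.refl t)⟩

/-! ### Opposition -/

theorem neg_subset_closure_neg {V : Type*} [NormedAddCommGroup V] {F F' : Set V}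
    (h : F' ⊆ _root_.closure F) : -F' ⊆ _root_.closure (-F) := by
  rw [← neg_closure]
  exact neg_subset_neg.2 h

theorem Opposite.of_parallel (hs : s₁.Parallel s) (h : s.Opposite t) (ht : t.Parallel t₁) :
    s₁.Opposite t₁ := by
  obtain ⟨F, h⟩ := opposite_iff.1 h
  exact opposite_iff.2 ⟨F, hs.hasDirections₂ ht h⟩

theorem Opposite.eq_neg (h : s.Opposite t) (hd : S.HasDirections s.germ t.germ F G) : G = -F := by
  obtain ⟨E, h⟩ := opposite_iff.1 h
  obtain ⟨w, -, rfl, rfl⟩ := h.exists_weyl hd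
  exact image_neg_of_apply_neg_eq_neg fun x _ => map_neg w x

theorem exists_opposite_dominates_iff (s u : S.SphericalSectorFace) :
    (∃ t : S.SphericalSectorFace, s.Opposite t ∧ t.Dominates u) ↔
      ∃ t₁ : S.SphericalSectorFace, s.Dominates t₁ ∧ t₁.Opposite u := by
  constructor
  · rintro ⟨t, hst, htu⟩
    obtain ⟨F, hd⟩ := opposite_iff.1 hst
    obtain ⟨G, hsub, hG, hF, f, hf, y, x, hu, hs⟩ := htu.hasDirections hd.symm
    refine ⟨ofChart hf hG.neg x, ⟨f, hf, x, x, F, -G, hF, hG.neg, ?_, hs, germ_ofChart _ _ _⟩,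
      ⟨f, hf, x, y, -G, hG.neg, germ_ofChart _ _ _, by rwa [neg_neg]⟩⟩
    simpa using neg_subset_closure_neg hsub
  · rintro ⟨t, hst, htu⟩
    obtain ⟨F, G, hd⟩ := exists_hasDirections s u
    obtain ⟨F', hsub, hd'⟩ := hst.hasDirections hd
    obtain rfl := htu.eq_neg hd'
    obtain ⟨hF, hG, f, hf, x, y, hs, hu⟩ := hd
    exact ⟨ofChart hf hF.neg x, ⟨f, hf, x, x, F, hF, hs, germ_ofChart _ _ _⟩,
      ⟨f, hf, x, y, -F, -F', hF.neg, hG, neg_subset_closure_neg hsub, germ_ofChart _ _ _, hu⟩⟩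

theorem exists_opposite_dominated_iff (s u : S.SphericalSectorFace) :
    (∃ t : S.SphericalSectorFace, s.Opposite t ∧ u.Dominates t) ↔
      ∃ t₁ : S.SphericalSectorFace, t₁.Dominates s ∧ t₁.Opposite u := by
  have hswap (v : S.SphericalSectorFace) {P : S.SphericalSectorFace → Prop} :
      (∃ t, v.Opposite t ∧ P t) ↔ ∃ t, P t ∧ t.Opposite v :=
    exists_congr fun t => and_comm.trans (and_congr_right fun _ => ⟨.symm, .symm⟩)
  rw [hswap s, ← exists_opposite_dominates_iff u s, hswap u]

end SphericalSectorFace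

end AffineHovel

end Hovel

theorem proposition3p2 {V ι : Type*} [NormedAddCommGroup V] [NormedSpace ℝ V]
    [FiniteDimensional ℝ V] [Fintype ι] (𝔸 : Hovel.Apartment V ι) {X : Type*}
    (S : Hovel.AffineHovel 𝔸 X) :
    -- parallelism is an equivalence relation
    Equivalence (fun s t : S.SphericalSectorFace => s.Parallel t) ∧
    -- dominance is a preorder, compatible with parallelism
    (∀ s : S.SphericalSectorFace, s.Dominates s) ∧
    (∀ s t u : S.SphericalSectorFace, s.Dominates t → t.Dominates u → s.Dominates u) ∧
    (∀ s s₁ t t₁ : S.SphericalSectorFace,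
      s₁.Parallel s → s.Dominates t → t.Parallel t₁ → s₁.Dominates t₁) ∧
    -- parallelism is the equivalence relation associated with dominance
    (∀ s t : S.SphericalSectorFace, s.Parallel t ↔ s.Dominates t ∧ t.Dominates s) ∧
    -- dominance in terms of closures
    (∀ s t : S.SphericalSectorFace,
      s.Dominates t ↔ ∃ t₁ : S.SphericalSectorFace, t₁.Parallel t ∧ t₁.1 ⊆ s.closure) ∧
    (∀ s t : S.SphericalSectorFace,
      s.Dominates t ↔ ∃ s₁ : S.SphericalSectorFace, s₁.Parallel s ∧ t.1 ⊆ s₁.closure) ∧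
    -- opposition is symmetric, and compatible with parallelism and dominance
    (∀ s t : S.SphericalSectorFace, s.Opposite t → t.Opposite s) ∧
    (∀ s s₁ t t₁ : S.SphericalSectorFace,
      s₁.Parallel s → s.Opposite t → t.Parallel t₁ → s₁.Opposite t₁) ∧
    (∀ s u : S.SphericalSectorFace,
      (∃ t : S.SphericalSectorFace, s.Opposite t ∧ t.Dominates u) ↔
        ∃ t₁ : S.SphericalSectorFace, s.Dominates t₁ ∧ t₁.Opposite u) ∧
    (∀ s u : S.SphericalSectorFace,
      (∃ t : S.SphericalSectorFace, s.Opposite t ∧ u.Dominates t) ↔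
        ∃ t₁ : S.SphericalSectorFace, t₁.Dominates s ∧ t₁.Opposite u) := by
  refine ⟨⟨.refl, .symm, .trans⟩, fun s => ?_, fun _ _ _ => .trans, fun _ _ _ _ => .of_parallel,
    fun _ _ => Hovel.AffineHovel.SphericalSectorFace.parallel_iff_dominates,
    fun _ _ => Hovel.AffineHovel.SphericalSectorFace.dominates_iff_exists_parallel_subset,
    fun _ _ => Hovel.AffineHovel.SphericalSectorFace.dominates_iff_exists_parallel_superset,
    fun _ _ => .symm, fun _ _ _ _ => .of_parallel,
    Hovel.AffineHovel.SphericalSectorFace.exists_opposite_dominates_iff,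
    Hovel.AffineHovel.SphericalSectorFace.exists_opposite_dominated_iff⟩
  exact (Hovel.AffineHovel.SphericalSectorFace.Parallel.refl s).dominates
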